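/- Let $n\ge 1$ and let $(G_k)_{k\ge 0}$ be an arbitrary sequence of connected undirected simple graphs on the vertex set $V=\{1,\dots,n\}$; put $\mathcal G(t)=G_{\lfloor t\rfloor}$ for $t\ge 0$. Let $d_i(t)$ be the degree of $i$ in $\mathcal G(t)$. For every edge $\{i,j\}$ of $\mathcal G(t)$ let $\lambda_{ij}(t)=1/\max\{d_i(t),d_j(t)\}$, let $\lambda_{ij}(t)=0$ if $i\ne j$ and $\{i,j\}$ is not an edge of $\mathcal G(t)$, and let $\lambda_{ii}(t)=1-\frac12\sum_{j\ne i}\lambda_{ij}(t)$ be the rate of a self-loop at $i$. To every unordered pair $\{i,j\}$ (with $i=j$ allowed) attach a Poisson process with rate $\lambda_{ij}(t)$ at time $t$, all these processes being independent. Each node $i$ holds an integer value $x_i(t)$, with deterministic initial value $x_i(0)\in[l,L]$, where $l,L$ are integers. The values change only when a process registers an arrival: at an arrival of $\{i,j\}$ with $i\ne j$ the value $x_i$ is replaced by $x_i-1$ if $x_i>x_j$, by $x_i+1$ if $x_i<x_j$, and is unchanged if $x_i=x_j$, and simultaneously $x_j$ is changed by the same rule with the roles of $i$ and $j$ exchanged;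 an arrival of a self-loop changes nothing. Let $\bar x(0)=\frac1n\sum_i x_i(0)$, let $$\mathcal C=\Big\{y\in\mathbb Z^n:\ y_i\in\{\lfloor\bar x(0)\rfloor,\lfloor\bar x(0)\rfloor+1\}\ \text{for all } i,\ \ \tfrac1n\sum_i y_i=\bar x(0)\Big\}$$ be the consensus set, and let $T=\inf\{t\ge 0: x(t)\in\mathcal C\}$ (with $\inf\emptyset=\infty$). Then there is a universal constant $C>0$, independent of $n$, of the graph sequence, of $l$ and $L$ and of the initial values, such that $$\mathbb E[T]\le C\,(L-l)\,n^2\log^2 n .$$ In particular, for a fixed range $[l,L]$ of the initial values, the expected time to reach the consensus set is $O(n^2\log^2 n)$, uniformly over all sequences of connected graphs on $n$ nodes and all initial values in $[l,L]$. -/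

import Mathlib

open MeasureTheory ProbabilityTheory
open scoped NNReal ENNReal

namespace QuantizedMetropolis

noncomputable section

/-- The Metropolis weight `λ_{ij} = 1 / max (d_i) (d_j)` of an edge `{i, j}`; it is `0` if `{i, j}`
is not an edge. -/
def edgeRate {n : ℕ} (G : SimpleGraph (Fin n)) (i j : Fin n) : ℝ :=
  open Classical in
  if G.Adj i j then 1 / (max (G.degree i) (G.degree j) : ℝ) else 0

/-- The rate `λ_{ii} = 1 - (1/2) ∑_j λ_{ij}` of the self-loop at `i`, where the sum is over the
neighbours `j ≠ i` of `i`. -/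
def loopRate {n : ℕ} (G : SimpleGraph (Fin n)) (i : Fin n) : ℝ :=
  open Classical in
  1 - (1 / 2) * ∑ j ∈ G.neighborFinset i, edgeRate G i j

lemma edgeRate_comm {n : ℕ} (G : SimpleGraph (Fin n)) (i j : Fin n) :
    edgeRate G i j = edgeRate G j i := by
  by_cases h : G.Adj i j
  · simp only [edgeRate, h, h.symm, if_true, max_comm]
  · have h2 : ¬ G.Adj j i := fun h3 => h h3.symm
    simp only [edgeRate, h, h2, if_false]

/-- The rate of the clock of the unordered pair `e`: the self-loop rate if `e = {i, i}`, the
Metropolis weight if `e` is an edge of `G`, and `0` (no clock) otherwise. -/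
def clockRate {n : ℕ} (G : SimpleGraph (Fin n)) : Sym2 (Fin n) → ℝ :=
  Sym2.lift ⟨fun i j => if i = j then loopRate G i else edgeRate G i j, fun i j => by
    by_cases h : i = j
    · subst h; rfl
    · simp only [h, Ne.symm h, if_false, edgeRate_comm G i j]⟩

/-- The new value of a node with value `a` when it interacts with a node with value `b`. -/
def step (a b : ℤ) : ℤ :=
  if b < a then a - 1 else if a < b then a + 1 else a

/-- The quantized update of the values `x` when the pair `e = {i, j}` is activated: both endpoints
move by one towards each other (not at all if they are equal); a self-loop changes nothing. -/
def update {n : ℕ} (e : Sym2 (Fin n)) (x : Fin n → ℤ) : Fin n → ℤ :=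
  Sym2.lift ⟨fun i j k =>
      if k = i then step (x i) (x j) else if k = j then step (x j) (x i) else x k,
    fun i j => by
      funext k
      by_cases hi : k = i <;> by_cases hj : k = j
      · subst hi; subst hj; rfl
      · simp [hi, show i ≠ j from fun h => hj (hi.trans h)]
      · simp [hj, show j ≠ i from fun h => hi (hj.trans h)]
      · simp [hi, hj]⟩ e

/-- The average of the values `x`. -/
def average {n : ℕ} (x : Fin n → ℤ) : ℝ := (∑ i, (x i : ℝ)) / n

/-- The consensus set of the initial values `x₀`. -/
def consensusSet {n : ℕ} (x₀ : Fin n → ℤ) : Set (Fin n → ℤ) :=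
  {y | (∀ i, y i = ⌊average x₀⌋ ∨ y i = ⌊average x₀⌋ + 1) ∧ average y = average x₀}

/-- `N` is an (inhomogeneous) Poisson process with rate function `rate`; `N t ω` is the number of
arrivals in `(0, t]`. -/
structure IsPoissonClock {Ω : Type*} [MeasurableSpace Ω] (P : Measure Ω)
    (N : ℝ≥0 → Ω → ℕ) (rate : ℝ → ℝ) : Prop where
  measurable : ∀ t, Measurable (N t)
  /-- Almost surely, the path is a counting path: it starts at `0`, is nondecreasing and
  right-continuous. -/
  path : ∀ᵐ ω ∂P, N 0 ω = 0 ∧ (Monotone fun t => N t ω) ∧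
    ∀ t, ContinuousWithinAt (fun s => N s ω) (Set.Ici t) t
  indep_increments : HasIndepIncrements N P
  law_increments : ∀ s t : ℝ≥0, s ≤ t →
    HasLaw (fun ω => N t ω - N s ω)
      (poissonMeasure (Real.toNNReal (∫ u in (s : ℝ)..(t : ℝ), rate u))) P

/-- The clocks of the time-varying network `𝒢(t) = G ⌊t⌋`: independent Poisson processes, one for
each edge and each self-loop, with rates given at time `t` by `𝒢(t)`. -/
structure AreMetropolisClocks {Ω : Type*} [MeasurableSpace Ω] (P : Measure Ω) {n : ℕ}
    (G : ℕ → SimpleGraph (Fin n)) (N : Sym2 (Fin n) → ℝ≥0 → Ω → ℕ) : Prop where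
  poisson : ∀ e, IsPoissonClock P (N e) fun u => clockRate (G ⌊u⌋₊) e
  indep : iIndepFun (fun e ω t => N e t ω) P

/-- The path `x` starts at `x₀`, stays constant as long as no clock registers an arrival, and is
updated at `e` when the clock of `e` registers an arrival: over a time interval `(s, t]` without
any arrival nothing changes, and over a time interval `(s, t]` with exactly one arrival, at `e`,
the values are transformed by the update at `e`. (Almost surely arrivals are locally finite
and no two are simultaneous, so this determines the path.) -/
structure IsDrivenPath {n : ℕ} (N : Sym2 (Fin n) → ℝ≥0 → ℕ) (x₀ : Fin n → ℤ)
    (x : ℝ≥0 → Fin n → ℤ) : Prop where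
  initial : x 0 = x₀
  no_arrival : ∀ s t, s ≤ t → (∀ e, N e t = N e s) → x t = x s
  one_arrival : ∀ s t e, s ≤ t → N e t = N e s + 1 → (∀ e', e' ≠ e → N e' t = N e' s) →
    x t = update e (x s)

/-- `X` is the quantized Metropolis dynamics over the time-varying network `𝒢(t) = G ⌊t⌋`, with
clocks `N` and initial values `x₀`. -/
structure IsQuantizedMetropolis {Ω : Type*} [MeasurableSpace Ω] (P : Measure Ω) {n : ℕ}
    (G : ℕ → SimpleGraph (Fin n)) (N : Sym2 (Fin n) → ℝ≥0 → Ω → ℕ) (x₀ : Fin n → ℤ)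
    (X : ℝ≥0 → Ω → Fin n → ℤ) : Prop where
  clocks : AreMetropolisClocks P G N
  measurable : ∀ t, Measurable (X t)
  driven : ∀ᵐ ω ∂P, IsDrivenPath (fun e t => N e t ω) x₀ fun t => X t ω

/-- The first time at which the path `x` is in the set `S`, and `∞` if there is none. -/
def hittingTime {n : ℕ} (x : ℝ≥0 → Fin n → ℤ) (S : Set (Fin n → ℤ)) : ℝ≥0∞ :=
  ⨅ (t : ℝ≥0) (_ : x t ∈ S), (t : ℝ≥0∞)

end

end QuantizedMetropolis

/-! Start from a state with extreme values `M` and `m`, where `M ≥ m + 2`. Values never leave `[m,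
M]`, and a node can hold `M` after an activation of `e` only if its image under the transposition of
`e` held `M` before; the same is true of `m`. If `e` joins a holder of `M` to a holder of `m`, both
lose their values. Hence `u k a b`, the probability that after `k` steps `a` holds `M` and `b` holds
`m`, is a subsolution of a walk of two particles that are moved by transpositions and killed when an
activated pair joins them (`evolve_extremePair_succ_le`).

This walk contracts the `L²` norm at a rate of order `1 / n²` for every connected graph. For fixed
`b` the function `a ↦ u a b` vanishes at `b`, and effective resistances are at most `6 n`
(`sq_le_dirichlet`) because degrees along a geodesic add up to at most `3 n`. Summation over `a`
costs another factor `n`, which gives the Poincaré constant `6 n²` (`sum_sq_le_dirichlet`). Each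
step is estimated separately, so the graph may change arbitrarily in time.

By Cauchy–Schwarz, the sum of `u` is at most `1 / 2` after a time of order `n² log n`, so the
expected excess of the spread over `1` drops by at least `1 / 2` from any state of spread at least
`2` (`evolve_excess_le`). Telescoping bounds the expected number of such time blocks that begin with
a wide state (`sum_evolve_wide_le`). The argument yields `n² log n`; the second logarithm is given
away at the end.

Continuous time is handled by a grid of mesh `1 / K`. Unless some cell contains several arrivals, an
event of probability `O(1 / K)` over a bounded time, the sampled path is a discrete chain with
independent inputs (`integral_traj`). Then `K → ∞` with the observation times fixed. -/

namespace QuantizedMetropolis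

noncomputable section

variable {n : ℕ}

/-! ### Effective resistance of the Metropolis weights -/

/-- The squared increment of `f` along an unordered pair. -/
def sqDiff (f : Fin n → ℝ) : Sym2 (Fin n) → ℝ :=
  Sym2.lift ⟨fun i j => (f i - f j) ^ 2, fun i j => by ring⟩

@[simp] lemma sqDiff_mk (f : Fin n → ℝ) (i j : Fin n) : sqDiff f s(i, j) = (f i - f j) ^ 2 := rfl

lemma sqDiff_nonneg (f : Fin n → ℝ) (e : Sym2 (Fin n)) : 0 ≤ sqDiff f e := by
  induction e with | _ i j => simpa using sq_nonneg _

/-- The nonnegative part of the rate of the clock of `e`. -/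
def posRate (G : SimpleGraph (Fin n)) (e : Sym2 (Fin n)) : ℝ := max (clockRate G e) 0

lemma posRate_nonneg (G : SimpleGraph (Fin n)) (e : Sym2 (Fin n)) : 0 ≤ posRate G e :=
  le_max_right _ _

open Classical in
lemma clockRate_adj {G : SimpleGraph (Fin n)} {i j : Fin n} (h : G.Adj i j) :
    clockRate G s(i, j) = 1 / (max (G.degree i) (G.degree j) : ℝ) := by
  simp [clockRate, h.ne, edgeRate, h]

lemma edgeRate_nonneg (G : SimpleGraph (Fin n)) (i j : Fin n) : 0 ≤ edgeRate G i j := by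
  unfold edgeRate; split_ifs <;> positivity

lemma edgeRate_le_one (G : SimpleGraph (Fin n)) (i j : Fin n) : edgeRate G i j ≤ 1 := by
  classical
  unfold edgeRate
  split_ifs with h
  · have h1 : (1 : ℝ) ≤ G.degree i := by
      exact_mod_cast (G.degree_pos_iff_exists_adj i).2 ⟨j, h⟩
    have h2 : (1 : ℝ) ≤ max (G.degree i : ℝ) (G.degree j) := h1.trans (le_max_left _ _)
    convert! (div_le_one (by linarith)).2 h2
  · norm_num

lemma posRate_le_one (G : SimpleGraph (Fin n)) (e : Sym2 (Fin n)) : posRate G e ≤ 1 := by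
  classical
  induction e with | _ i j =>
  refine max_le ?_ zero_le_one
  change (if i = j then loopRate G i else edgeRate G i j) ≤ 1
  split_ifs
  · have := Finset.sum_nonneg fun k (_ : k ∈ G.neighborFinset i) => edgeRate_nonneg G i k
    unfold loopRate
    convert! (show 1 - 1 / 2 * ∑ k ∈ G.neighborFinset i, edgeRate G i k ≤ 1 by linarith)
  · exact edgeRate_le_one G i j

/-- A geodesic from `b` to `a`. -/
lemma exists_geodesic {G : SimpleGraph (Fin n)} (hG : G.Connected) (b : Fin n) :
    ∀ (r : ℕ) (a : Fin n), G.dist b a = r → ∃ w : ℕ → Fin n, w 0 = b ∧ w r = a ∧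
      (∀ k ≤ r, G.dist b (w k) = k) ∧ ∀ k < r, G.Adj (w k) (w (k + 1)) := by
  intro r
  induction r with
  | zero =>
    intro a ha
    refine ⟨fun _ => b, rfl, (hG.dist_eq_zero_iff.1 ha), fun k hk => ?_, fun k hk => by omega⟩
    simp [Nat.le_zero.1 hk]
  | succ r ih =>
    intro a ha
    obtain ⟨p, hp⟩ := hG.exists_walk_length_eq_dist a b
    rw [SimpleGraph.dist_comm, ha] at hp
    cases p with
    | nil => simp at hp
    | @cons _ c _ h q =>
      have hq : q.length = r := by simpa using hp
      have h1 : G.dist b c ≤ r := by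
        rw [SimpleGraph.dist_comm]; exact (SimpleGraph.dist_le q).trans hq.le
      have h2 : G.dist b a ≤ G.dist b c + 1 := by
        refine (hG.dist_triangle (v := c)).trans ?_
        rw [SimpleGraph.dist_eq_one_iff_adj.2 h.symm]
      obtain ⟨w, w0, wr, wd, wa⟩ := ih c (by omega)
      refine ⟨fun k => if k ≤ r then w k else a, by simp [w0], by simp, fun k hk => ?_,
        fun k hk => ?_⟩
      · by_cases hkr : k ≤ r
        · simpa [hkr] using wd k hkr
        · obtain rfl : k = r + 1 := by omega
          simpa using ha
      · by_cases hkr : k < r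
        · simpa [hkr.le, Nat.succ_le_of_lt hkr] using wa k hkr
        · obtain rfl : k = r := by omega
          simpa [wr] using h.symm

open Classical in
/-- The vertices of a geodesic have total degree at most `3 n`: a vertex is adjacent to at most
three of them. -/
lemma sum_degree_geodesic_le {G : SimpleGraph (Fin n)} (hG : G.Connected) (b : Fin n) (r : ℕ)
    (w : ℕ → Fin n) (hw : ∀ k ≤ r, G.dist b (w k) = k) :
    ∑ k ∈ Finset.range (r + 1), G.degree (w k) ≤ 3 * n := by
  have h1 : ∀ k ∈ Finset.range (r + 1),
      G.degree (w k) = ∑ v : Fin n, if G.Adj (w k) v then 1 else 0 := by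
    intro k _
    rw [← SimpleGraph.card_neighborFinset_eq_degree, Finset.card_eq_sum_ones,
      ← Finset.sum_filter]
    congr 1; ext; simp
  rw [Finset.sum_congr rfl h1, Finset.sum_comm]
  have h2 : ∀ v ∈ (Finset.univ : Finset (Fin n)),
      (∑ k ∈ Finset.range (r + 1), if G.Adj (w k) v then 1 else 0) ≤ 3 := by
    intro v _
    rw [← Finset.sum_filter, ← Finset.card_eq_sum_ones]
    -- Neighbours of `v` lie at distance within `1` of `G.dist b v`, and `w k` is at distance `k`.
    -- The truncated subtraction at `0` only shortens the interval.
    have h3 : (Finset.range (r + 1)).filter (fun k => G.Adj (w k) v) ⊆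
        Finset.Icc (G.dist b v - 1) (G.dist b v + 1) := by
      intro k hk
      simp only [Finset.mem_filter, Finset.mem_range] at hk
      have h4 := hw k (by omega)
      have h5 := SimpleGraph.dist_eq_one_iff_adj.2 hk.2
      have h6 : G.dist b v ≤ G.dist b (w k) + G.dist (w k) v := hG.dist_triangle
      have h7 : G.dist b (w k) ≤ G.dist b v + G.dist v (w k) := hG.dist_triangle
      rw [SimpleGraph.dist_comm (u := v)] at h7
      simp only [Finset.mem_Icc]
      omega
    refine (Finset.card_le_card h3).trans ?_
    simp only [Nat.card_Icc]
    omega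
  refine (Finset.sum_le_sum h2).trans ?_
  simp [mul_comm]

/-- The effective resistance between two vertices is at most `6 n`. -/
theorem sq_le_dirichlet {G : SimpleGraph (Fin n)} (hG : G.Connected) (f : Fin n → ℝ) (a b : Fin n)
    (hb : f b = 0) : f a ^ 2 ≤ 6 * n * ∑ e, posRate G e * sqDiff f e := by
  classical
  obtain ⟨w, w0, wr, wd, wa⟩ := exists_geodesic hG b _ a rfl
  set r := G.dist b a
  set c : ℕ → ℝ := fun k => max (G.degree (w k) : ℝ) (G.degree (w (k + 1))) with hc
  have hcpos : ∀ k ∈ Finset.range r, 0 < c k := by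
    intro k hk
    have : 0 < G.degree (w k) :=
      (G.degree_pos_iff_exists_adj _).2 ⟨_, wa k (Finset.mem_range.1 hk)⟩
    exact lt_max_of_lt_left (by exact_mod_cast this)
  have htel : f a = ∑ k ∈ Finset.range r, (f (w (k + 1)) - f (w k)) := by
    rw [Finset.sum_range_sub (fun k => f (w k)), w0, wr, hb, sub_zero]
  -- The resistance `c k` is at most the sum of the two endpoint degrees, so each vertex of the
  -- geodesic is counted at most twice: `2 * 3 n`.
  have hsum : ∑ k ∈ Finset.range r, c k ≤ 6 * n := by
    have hd := sum_degree_geodesic_le hG b r w wd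
    have h1 : ∑ k ∈ Finset.range r, c k ≤
        ∑ k ∈ Finset.range r, (G.degree (w k) : ℝ) +
        ∑ k ∈ Finset.range r, (G.degree (w (k + 1)) : ℝ) := by
      rw [← Finset.sum_add_distrib]
      exact Finset.sum_le_sum fun k _ => max_le (by simp) (by simp)
    have h2 := Finset.sum_range_succ (fun k => (G.degree (w k) : ℝ)) r
    have h3 := Finset.sum_range_succ' (fun k => (G.degree (w k) : ℝ)) r
    have h4 : ∑ k ∈ Finset.range (r + 1), (G.degree (w k) : ℝ) ≤ 3 * n := by exact_mod_cast hd
    have h5 : (0 : ℝ) ≤ G.degree (w r) := by positivity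
    have h6 : (0 : ℝ) ≤ G.degree (w 0) := by positivity
    linarith
  have hcs : f a ^ 2 ≤ (∑ k ∈ Finset.range r, c k) *
      ∑ k ∈ Finset.range r, (f (w (k + 1)) - f (w k)) ^ 2 / c k := by
    rw [htel]
    refine Finset.sum_sq_le_sum_mul_sum_of_sq_le_mul _ (fun k hk => (hcpos k hk).le)
      (fun k hk => div_nonneg (sq_nonneg _) (hcpos k hk).le) fun k hk => ?_
    rw [mul_div_cancel₀ _ (hcpos k hk).ne']
  -- Distances to `b` tell the edges of the geodesic apart, so each enters the Dirichlet sum once.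
  have hinj : Set.InjOn (fun k => s(w k, w (k + 1))) (Finset.range r : Set ℕ) := by
    intro k hk k' hk' h
    simp only [Finset.coe_range, Set.mem_Iio] at hk hk'
    have := congrArg (Sym2.map (G.dist b)) h
    simp only [Sym2.map_mk, wd k hk.le, wd (k + 1) hk, wd k' hk'.le, wd (k' + 1) hk',
      Sym2.eq_iff] at this
    omega
  have hdir : ∑ k ∈ Finset.range r, (f (w (k + 1)) - f (w k)) ^ 2 / c k ≤
      ∑ e, posRate G e * sqDiff f e := by
    have h1 : ∑ k ∈ Finset.range r, (f (w (k + 1)) - f (w k)) ^ 2 / c k ≤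
        ∑ k ∈ Finset.range r, posRate G s(w k, w (k + 1)) * sqDiff f s(w k, w (k + 1)) := by
      refine Finset.sum_le_sum fun k hk => ?_
      have h2 : 1 / c k ≤ posRate G s(w k, w (k + 1)) := by
        have h3 := clockRate_adj (wa k (Finset.mem_range.1 hk))
        refine le_trans (le_of_eq ?_) (le_max_left _ _)
        rw [h3]
      rw [sqDiff_mk, div_eq_mul_one_div, mul_comm,
        show (f (w (k + 1)) - f (w k)) ^ 2 = (f (w k) - f (w (k + 1))) ^ 2 by ring]
      exact mul_le_mul_of_nonneg_right h2 (sq_nonneg _)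
    refine h1.trans ?_
    rw [← Finset.sum_image (f := fun e => posRate G e * sqDiff f e) hinj]
    exact Finset.sum_le_sum_of_subset_of_nonneg (Finset.subset_univ _)
      fun e _ _ => mul_nonneg (posRate_nonneg G e) (sqDiff_nonneg f e)
  refine hcs.trans (mul_le_mul hsum hdir ?_ (by positivity))
  exact Finset.sum_nonneg fun k hk => div_nonneg (sq_nonneg _) (hcpos k hk).le

/-! ### The killed pair walk -/

/-- The transposition of the endpoints of `e`. -/
def swapPerm (e : Sym2 (Fin n)) : Equiv.Perm (Fin n) :=
  Sym2.lift ⟨fun i j => Equiv.swap i j, fun i j => Equiv.swap_comm i j⟩ e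

@[simp] lemma swapPerm_mk (i j : Fin n) : swapPerm s(i, j) = Equiv.swap i j := rfl

/-- The action of `e` on functions of a pair of particles: the particles move along `e`, and they
are killed if `e` joins them. -/
def pairMove (e : Sym2 (Fin n)) (u : Fin n → Fin n → ℝ) (a b : Fin n) : ℝ :=
  if e = s(a, b) then 0 else u (swapPerm e a) (swapPerm e b)

lemma sum_sq_pairMove_le (e : Sym2 (Fin n)) (u : Fin n → Fin n → ℝ) :
    ∑ a, ∑ b, pairMove e u a b ^ 2 ≤ ∑ a, ∑ b, u a b ^ 2 := by
  rw [← Equiv.sum_comp (swapPerm e) fun a => ∑ b, u a b ^ 2]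
  refine Finset.sum_le_sum fun a _ => ?_
  rw [← Equiv.sum_comp (swapPerm e) fun b => u (swapPerm e a) b ^ 2]
  refine Finset.sum_le_sum fun b _ => ?_
  unfold pairMove
  split_ifs
  · simpa using sq_nonneg _
  · exact le_rfl

lemma sum_sqDiff_le (e : Sym2 (Fin n)) (u : Fin n → Fin n → ℝ) (hu : ∀ a, u a a = 0) :
    ∑ b, sqDiff (fun a => u a b) e ≤ ∑ a, ∑ b, (u a b - pairMove e u a b) ^ 2 := by
  rw [Finset.sum_comm]
  refine Finset.sum_le_sum fun b _ => ?_
  induction e with | _ i j =>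
  rw [sqDiff_mk]
  -- If `b` is an endpoint of the pair, take `a` to be the other endpoint: killing replaces the
  -- value by `0`, which is the value on the diagonal. Otherwise only the first particle moves, and
  -- `a = i` works.
  have key : ∃ a, (u i b - u j b) ^ 2 = (u a b - pairMove s(i, j) u a b) ^ 2 := by
    by_cases hbi : b = i
    · subst hbi
      exact ⟨j, by simp [pairMove, hu, Sym2.eq_swap]⟩
    · refine ⟨i, ?_⟩
      by_cases hbj : b = j
      · subst hbj
        simp [pairMove, hu]
      · have : s(i, j) ≠ s(i, b) := by
          simp only [ne_eq, Sym2.eq_iff]; tauto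
        rw [pairMove, if_neg this, swapPerm_mk, Equiv.swap_apply_left,
          Equiv.swap_apply_of_ne_of_ne hbi hbj]
  obtain ⟨a, ha⟩ := key
  rw [ha]
  exact Finset.single_le_sum (f := fun a => (u a b - pairMove s(i, j) u a b) ^ 2)
    (fun a _ => sq_nonneg _) (Finset.mem_univ a)

/-- One step of the killed pair walk in which `e` is activated with probability `p e`. -/
def pairStep (p : Sym2 (Fin n) → ℝ) (u : Fin n → Fin n → ℝ) (a b : Fin n) : ℝ :=
  (1 - ∑ e, p e) * u a b + ∑ e, p e * pairMove e u a b

/-- The gain comes from the cross term between staying put and moving. Polarization, `2 x y = x² +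
y² - (x - y)²`, turns it into norms minus squared increments, and each move is an `L²` contraction.
The factor `1 - ∑ e, p e` is the holding probability. -/
lemma sum_sq_pairStep_le (p : Sym2 (Fin n) → ℝ) (hp : ∀ e, 0 ≤ p e) (hq : ∑ e, p e ≤ 1)
    (u : Fin n → Fin n → ℝ) (hu : ∀ a, u a a = 0) :
    ∑ a, ∑ b, pairStep p u a b ^ 2 ≤ ∑ a, ∑ b, u a b ^ 2 -
      (1 - ∑ e, p e) * ∑ e, p e * ∑ b, sqDiff (fun a => u a b) e := by
  set q := ∑ e, p e with hqdef
  set S := ∑ a, ∑ b, u a b ^ 2 with hS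
  have hcs : ∀ a b, (∑ e, p e * pairMove e u a b) ^ 2 ≤ q * ∑ e, p e * pairMove e u a b ^ 2 := by
    intro a b
    refine Finset.sum_sq_le_sum_mul_sum_of_sq_le_mul _ (fun e _ => hp e)
      (fun e _ => mul_nonneg (hp e) (sq_nonneg _)) fun e _ => le_of_eq (by ring)
  have hpt : ∀ a b, pairStep p u a b ^ 2 ≤ (1 - q) ^ 2 * u a b ^ 2
      + (1 - q) * ∑ e, p e * (u a b ^ 2 + pairMove e u a b ^ 2
        - (u a b - pairMove e u a b) ^ 2) + q * ∑ e, p e * pairMove e u a b ^ 2 := by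
    intro a b
    have h1 : ∑ e, p e * (u a b ^ 2 + pairMove e u a b ^ 2 - (u a b - pairMove e u a b) ^ 2) =
        2 * u a b * ∑ e, p e * pairMove e u a b := by
      rw [Finset.mul_sum]; exact Finset.sum_congr rfl fun e _ => by ring
    rw [h1]
    have h2 := hcs a b
    unfold pairStep
    rw [← hqdef]
    nlinarith
  refine (Finset.sum_le_sum fun a _ => Finset.sum_le_sum fun b _ => hpt a b).trans ?_
  have hA : ∀ c : Sym2 (Fin n) → Fin n → Fin n → ℝ,
      ∑ a, ∑ b, ∑ e, p e * c e a b = ∑ e, p e * ∑ a, ∑ b, c e a b := by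
    intro c
    simp_rw [Finset.mul_sum]
    rw [Finset.sum_comm' (t' := Finset.univ) (s' := fun _ => Finset.univ) (by simp)]
    rw [Finset.sum_comm]
    rw [Finset.sum_congr rfl fun b _ => Finset.sum_comm, Finset.sum_comm]
  simp only [Finset.sum_add_distrib, Finset.sum_sub_distrib, ← Finset.mul_sum, hA]
  rw [← hS]
  have h3 : ∑ e, p e * (S + ∑ a, ∑ b, pairMove e u a b ^ 2 -
      ∑ a, ∑ b, (u a b - pairMove e u a b) ^ 2) ≤
      2 * q * S - ∑ e, p e * ∑ b, sqDiff (fun a => u a b) e := by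
    have : 2 * q * S - ∑ e, p e * ∑ b, sqDiff (fun a => u a b) e =
        ∑ e, p e * (2 * S - ∑ b, sqDiff (fun a => u a b) e) := by
      simp_rw [mul_sub, Finset.sum_sub_distrib]
      rw [← Finset.sum_mul]; ring
    rw [this]
    refine Finset.sum_le_sum fun e _ => mul_le_mul_of_nonneg_left ?_ (hp e)
    linarith [sum_sq_pairMove_le e u, sum_sqDiff_le e u hu]
  have h4 : ∑ e, p e * ∑ a, ∑ b, pairMove e u a b ^ 2 ≤ q * S := by
    rw [hqdef, Finset.sum_mul]
    exact Finset.sum_le_sum fun e _ => mul_le_mul_of_nonneg_left (sum_sq_pairMove_le e u) (hp e)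
  have hq0 : 0 ≤ q := Finset.sum_nonneg fun e _ => hp e
  have h5 := mul_le_mul_of_nonneg_left h3 (show 0 ≤ 1 - q by linarith)
  have h6 := mul_le_mul_of_nonneg_left h4 hq0
  nlinarith

/-- The Poincaré inequality for functions of a pair that vanish on the diagonal. -/
lemma sum_sq_le_dirichlet {G : SimpleGraph (Fin n)} (hG : G.Connected) (u : Fin n → Fin n → ℝ)
    (hu : ∀ a, u a a = 0) :
    ∑ a, ∑ b, u a b ^ 2 ≤
      6 * (n : ℝ) ^ 2 * ∑ e, posRate G e * ∑ b, sqDiff (fun a => u a b) e := by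
  have h : ∀ a b, u a b ^ 2 ≤ 6 * n * ∑ e, posRate G e * sqDiff (fun a => u a b) e :=
    fun a b => sq_le_dirichlet hG (fun a => u a b) a b (hu b)
  refine (Finset.sum_le_sum fun a _ => Finset.sum_le_sum fun b _ => h a b).trans (le_of_eq ?_)
  simp_rw [Finset.mul_sum]
  rw [Finset.sum_const, Finset.card_univ, Fintype.card_fin, nsmul_eq_mul, Finset.sum_comm,
    Finset.mul_sum]
  refine Finset.sum_congr rfl fun e _ => ?_
  rw [Finset.mul_sum]
  exact Finset.sum_congr rfl fun b _ => by ring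

/-- The killed pair walk contracts the `L²` norm. -/
lemma sum_sq_pairStep_le_mul {G : SimpleGraph (Fin n)} (hG : G.Connected)
    (p : Sym2 (Fin n) → ℝ) (c : ℝ) (hc : 0 ≤ c) (hp : ∀ e, c * posRate G e ≤ p e)
    (hq : ∑ e, p e ≤ 1) (u : Fin n → Fin n → ℝ) (hu : ∀ a, u a a = 0) :
    ∑ a, ∑ b, pairStep p u a b ^ 2 ≤
      (1 - (1 - ∑ e, p e) * c / (6 * (n : ℝ) ^ 2)) * ∑ a, ∑ b, u a b ^ 2 := by
  have hp0 : ∀ e, 0 ≤ p e := fun e => (mul_nonneg hc (posRate_nonneg G e)).trans (hp e)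
  have h1 := sum_sq_pairStep_le p hp0 hq u hu
  have h2 := sum_sq_le_dirichlet hG u hu
  have hn : (0 : ℝ) < n := by
    have : Nonempty (Fin n) := hG.nonempty
    exact_mod_cast Fin.pos_iff_nonempty.2 this
  have h3 : c * ∑ e, posRate G e * ∑ b, sqDiff (fun a => u a b) e ≤
      ∑ e, p e * ∑ b, sqDiff (fun a => u a b) e := by
    rw [Finset.mul_sum]
    refine Finset.sum_le_sum fun e _ => ?_
    rw [← mul_assoc]
    exact mul_le_mul_of_nonneg_right (hp e) (Finset.sum_nonneg fun b _ => sqDiff_nonneg _ e)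
  set S := ∑ a, ∑ b, u a b ^ 2
  set D := ∑ e, posRate G e * ∑ b, sqDiff (fun a => u a b) e
  have h4 : c * (S / (6 * (n : ℝ) ^ 2)) ≤ c * D :=
    mul_le_mul_of_nonneg_left ((div_le_iff₀ (by positivity)).2 (by linarith)) hc
  have h5 := mul_le_mul_of_nonneg_left (h4.trans h3) (show 0 ≤ 1 - ∑ e, p e by linarith)
  refine h1.trans ?_
  have h6 : (1 - (1 - ∑ e, p e) * c / (6 * (n : ℝ) ^ 2)) * S =
      S - (1 - ∑ e, p e) * (c * (S / (6 * (n : ℝ) ^ 2))) := by ring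
  rw [h6]
  linarith

/-! ### Extreme values under the quantized update -/

lemma update_mk (i j : Fin n) (y : Fin n → ℤ) (k : Fin n) : update s(i, j) y k =
    if k = i then step (y i) (y j) else if k = j then step (y j) (y i) else y k := rfl

/-- The states with values in `[m, M]`. -/
def box (n : ℕ) (m M : ℤ) : Set (Fin n → ℤ) := {y | ∀ i, m ≤ y i ∧ y i ≤ M}

lemma update_mem_box {m M : ℤ} (e : Sym2 (Fin n)) {y : Fin n → ℤ} (hy : y ∈ box n m M) :
    update e y ∈ box n m M := by
  induction e with | _ i j =>
  intro k
  have hi := hy i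
  have hj := hy j
  have hk := hy k
  rw [update_mk]
  unfold step
  split_ifs <;> omega

lemma sum_update (e : Sym2 (Fin n)) (y : Fin n → ℤ) : ∑ k, update e y k = ∑ k, y k := by
  induction e with | _ i j =>
  by_cases hij : i = j
  · subst hij
    refine Finset.sum_congr rfl fun k _ => ?_
    rw [update_mk]
    unfold step
    split_ifs <;> simp_all
  · have h : ∀ k, update s(i, j) y k = y k + ((if k = i then step (y i) (y j) - y i else 0) +
        if k = j then step (y j) (y i) - y j else 0) := by
      intro k
      rw [update_mk]
      split_ifs with h1 h2 <;> simp_all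
    simp_rw [h, Finset.sum_add_distrib]
    simp only [Finset.sum_ite_eq', Finset.mem_univ, if_true]
    unfold step
    split_ifs <;> omega

/-- The indicator of the event that node `a` has value `M` and node `b` has value `m`. -/
def extremePair (M m : ℤ) (a b : Fin n) (y : Fin n → ℤ) : ℝ := if y a = M ∧ y b = m then 1 else 0

/-- On values that differ by at most `1` the update is a transposition. On values further apart both
endpoints end strictly between the old values, so no extreme value is created. The gap of `2`
ensures that a maximum and a minimum that meet are both lost, which is the killing. -/
lemma extremePair_update_le {m M : ℤ} (hmM : m + 2 ≤ M) (e : Sym2 (Fin n)) {y : Fin n → ℤ}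
    (hy : y ∈ box n m M) (a b : Fin n) :
    extremePair M m a b (update e y) ≤
      pairMove e (fun a b => extremePair M m a b y) a b := by
  induction e with | _ i j =>
  by_cases h : update s(i, j) y a = M ∧ update s(i, j) y b = m
  · obtain ⟨ha, hb⟩ := h
    have hi := hy i
    have hj := hy j
    have hmax : y (Equiv.swap i j a) = M := by
      rw [update_mk] at ha
      rw [Equiv.swap_apply_def]
      unfold step at ha
      split_ifs at * <;> omega
    have hmin : y (Equiv.swap i j b) = m := by
      rw [update_mk] at hb
      rw [Equiv.swap_apply_def]
      unfold step at hb
      split_ifs at * <;> omega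
    have hne : s(i, j) ≠ s(a, b) := by
      intro h
      rcases Sym2.eq_iff.1 h with ⟨rfl, rfl⟩ | ⟨rfl, rfl⟩
      · rw [Equiv.swap_apply_left] at hmax
        rw [Equiv.swap_apply_right] at hmin
        rw [update_mk, if_pos rfl] at ha
        unfold step at ha
        split_ifs at ha <;> omega
      · rw [Equiv.swap_apply_right] at hmax
        rw [Equiv.swap_apply_left] at hmin
        rw [update_mk, if_pos rfl] at hb
        unfold step at hb
        split_ifs at hb <;> omega
    rw [pairMove, if_neg hne, swapPerm_mk]
    simp [extremePair, ha, hb, hmax, hmin]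
  · rw [extremePair, if_neg h]
    unfold pairMove extremePair
    dsimp only
    split_ifs <;> norm_num

/-! ### Transition operators of the discrete chain -/

/-- The transition operator of the chain in which `e` is activated with probability `p e`. -/
def stepOp (p : Sym2 (Fin n) → ℝ) : ((Fin n → ℤ) → ℝ) →ₗ[ℝ] ((Fin n → ℤ) → ℝ) where
  toFun f y := (1 - ∑ e, p e) * f y + ∑ e, p e * f (update e y)
  map_add' f g := by
    funext y
    simp only [Pi.add_apply, mul_add, Finset.sum_add_distrib]
    ring
  map_smul' c f := by
    funext y
    simp only [Pi.smul_apply, smul_eq_mul, RingHom.id_apply, mul_add, Finset.mul_sum]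
    congr 1
    · ring
    · exact Finset.sum_congr rfl fun e _ => by ring

lemma stepOp_apply (p : Sym2 (Fin n) → ℝ) (f : (Fin n → ℤ) → ℝ) (y : Fin n → ℤ) :
    stepOp p f y = (1 - ∑ e, p e) * f y + ∑ e, p e * f (update e y) := rfl

/-- The transition operator of the first `k` steps, where `p j` are the activation probabilities
of step `j`. -/
def evolve (p : ℕ → Sym2 (Fin n) → ℝ) : ℕ → ((Fin n → ℤ) → ℝ) →ₗ[ℝ] ((Fin n → ℤ) → ℝ)
  | 0 => LinearMap.id
  | k + 1 => evolve p k ∘ₗ stepOp (p k)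

lemma evolve_succ (p : ℕ → Sym2 (Fin n) → ℝ) (k : ℕ) (f : (Fin n → ℤ) → ℝ) :
    evolve p (k + 1) f = evolve p k (stepOp (p k) f) := rfl

lemma evolve_add (p : ℕ → Sym2 (Fin n) → ℝ) (k l : ℕ) (f : (Fin n → ℤ) → ℝ) :
    evolve p (k + l) f = evolve p k (evolve (fun j => p (k + j)) l f) := by
  induction l generalizing f with
  | zero => rfl
  | succ l ih => rw [← add_assoc, evolve_succ, ih, evolve_succ]

/-- A sequence of families of subprobabilities. -/
def IsSubprob (p : ℕ → Sym2 (Fin n) → ℝ) : Prop := ∀ j, (∀ e, 0 ≤ p j e) ∧ ∑ e, p j e ≤ 1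

lemma IsSubprob.shift {p : ℕ → Sym2 (Fin n) → ℝ} (hp : IsSubprob p) (k : ℕ) :
    IsSubprob fun j => p (k + j) := fun j => hp (k + j)

lemma evolve_mono {p : ℕ → Sym2 (Fin n) → ℝ} (hp : IsSubprob p) {S : Set (Fin n → ℤ)}
    (hS : ∀ e, ∀ y ∈ S, update e y ∈ S) (k : ℕ) {f g : (Fin n → ℤ) → ℝ}
    (hfg : ∀ y ∈ S, f y ≤ g y) : ∀ y ∈ S, evolve p k f y ≤ evolve p k g y := by
  induction k generalizing f g with
  | zero => exact hfg
  | succ k ih =>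
    refine ih fun y hy => ?_
    rw [stepOp_apply, stepOp_apply]
    have := (hp k).2
    gcongr with e _
    · exact hfg y hy
    · exact (hp k).1 e
    · exact hfg _ (hS e y hy)

lemma evolve_const (p : ℕ → Sym2 (Fin n) → ℝ) (k : ℕ) (c : ℝ) :
    evolve p k (fun _ => c) = fun _ => c := by
  induction k with
  | zero => rfl
  | succ k ih =>
    rw [evolve_succ]
    convert ih
    rw [stepOp_apply, ← Finset.sum_mul]
    ring

lemma evolve_box_mono {p : ℕ → Sym2 (Fin n) → ℝ} (hp : IsSubprob p) {m M : ℤ} (k : ℕ)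
    {f g : (Fin n → ℤ) → ℝ} (hfg : ∀ y ∈ box n m M, f y ≤ g y) :
    ∀ y ∈ box n m M, evolve p k f y ≤ evolve p k g y :=
  evolve_mono hp (fun e _ hy => update_mem_box e hy) k hfg

/-- The joint law of a maximal and a minimal value is a subsolution of the killed pair walk. -/
lemma evolve_extremePair_succ_le {p : ℕ → Sym2 (Fin n) → ℝ} (hp : IsSubprob p) {m M : ℤ}
    (hmM : m + 2 ≤ M) (k : ℕ) {y : Fin n → ℤ} (hy : y ∈ box n m M) (a b : Fin n) :
    evolve p (k + 1) (extremePair M m a b) y ≤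
      pairStep (p k) (fun a b => evolve p k (extremePair M m a b) y) a b := by
  have h1 : evolve p (k + 1) (extremePair M m a b) y ≤
      evolve p k ((1 - ∑ e, p k e) • extremePair M m a b + ∑ e, p k e •
        fun z => pairMove e (fun a b => extremePair M m a b z) a b) y := by
    rw [evolve_succ]
    refine evolve_box_mono hp k (fun z hz => ?_) y hy
    rw [stepOp_apply]
    simp only [Pi.add_apply, Pi.smul_apply, smul_eq_mul, Finset.sum_apply]
    gcongr with e _
    · exact (hp k).1 e
    · exact extremePair_update_le hmM e hz a b
  refine h1.trans (le_of_eq ?_)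
  rw [map_add, map_smul, map_sum]
  simp only [Pi.add_apply, Pi.smul_apply, smul_eq_mul, Finset.sum_apply, map_smul]
  unfold pairStep
  congr 1
  refine Finset.sum_congr rfl fun e _ => ?_
  congr 1
  unfold pairMove
  split_ifs
  · exact congrFun (evolve_const p k 0) y
  · rfl

/-! ### Decay of extreme pairs and drift of the spread -/

/-- The activation probabilities `p j` of the steps of length `h` are comparable to the rates of
connected graphs. -/
def HasRates (h : ℝ) (p : ℕ → Sym2 (Fin n) → ℝ) : Prop :=
  ∀ j, ∃ G : SimpleGraph (Fin n), G.Connected ∧ ∃ c : ℝ, 0 ≤ c ∧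
    (∀ e, c * posRate G e ≤ p j e) ∧ ∑ e, p j e ≤ 1 ∧ h / 4 ≤ (1 - ∑ e, p j e) * c

lemma HasRates.isSubprob {h : ℝ} {p : ℕ → Sym2 (Fin n) → ℝ} (hp : HasRates h p) :
    IsSubprob p := by
  intro j
  obtain ⟨G, _, c, hc, h1, h2, _⟩ := hp j
  exact ⟨fun e => (mul_nonneg hc (posRate_nonneg G e)).trans (h1 e), h2⟩

lemma HasRates.shift {h : ℝ} {p : ℕ → Sym2 (Fin n) → ℝ} (hp : HasRates h p) (k : ℕ) :
    HasRates h fun j => p (k + j) := fun j => hp (k + j)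

/-- Iteration of the subsolution property and the `L²` contraction. The Poincaré constant `6 n²` and
the factor `1 / 4` in `HasRates` combine to `24 n²`; the prefactor counts pairs. -/
lemma sum_sq_evolve_extremePair_le {h : ℝ} {p : ℕ → Sym2 (Fin n) → ℝ}
    (hp : HasRates h p) {m M : ℤ} (hmM : m + 2 ≤ M) (k : ℕ) {y : Fin n → ℤ}
    (hy : y ∈ box n m M) :
    ∑ a, ∑ b, evolve p k (extremePair M m a b) y ^ 2 ≤
      (n : ℝ) ^ 2 * Real.exp (-(h / (24 * (n : ℝ) ^ 2) * k)) := by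
  have hn0 : ∀ (k : ℕ) (a b : Fin n), 0 ≤ evolve p k (extremePair M m a b) y := by
    intro k a b
    have := evolve_box_mono hp.isSubprob (m := m) (M := M) k (f := fun _ => 0)
      (g := extremePair M m a b) (fun z _ => by unfold extremePair; split_ifs <;> norm_num) y hy
    rwa [evolve_const] at this
  induction k with
  | zero =>
    have h1 : ∀ a b : Fin n, evolve p 0 (extremePair M m a b) y ^ 2 ≤ 1 := by
      intro a b
      change extremePair M m a b y ^ 2 ≤ 1
      unfold extremePair
      split_ifs <;> norm_num
    refine (Finset.sum_le_sum fun a _ => Finset.sum_le_sum fun b _ => h1 a b).trans ?_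
    simp [sq]
  | succ k ih =>
    obtain ⟨G, hG, c, hc, h1, h2, h3⟩ := hp k
    -- One node cannot hold both values; this is the boundary condition that the Poincaré inequality
    -- needs.
    have hdiag : ∀ a : Fin n, evolve p k (extremePair M m a a) y = 0 := by
      intro a
      have : extremePair M m a a = fun _ => 0 := by
        funext z
        exact if_neg (by omega)
      rw [this, evolve_const]
    have hstep := sum_sq_pairStep_le_mul hG (p k) c hc h1 h2
      (fun a b => evolve p k (extremePair M m a b) y) hdiag
    have hmono : ∑ a, ∑ b, evolve p (k + 1) (extremePair M m a b) y ^ 2 ≤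
        ∑ a, ∑ b, pairStep (p k) (fun a b => evolve p k (extremePair M m a b) y) a b ^ 2 :=
      Finset.sum_le_sum fun a _ => Finset.sum_le_sum fun b _ =>
        pow_le_pow_left₀ (hn0 _ a b) (evolve_extremePair_succ_le hp.isSubprob hmM k hy a b) 2
    set S := ∑ a, ∑ b, evolve p k (extremePair M m a b) y ^ 2
    have hS : 0 ≤ S := Finset.sum_nonneg fun a _ => Finset.sum_nonneg fun b _ => sq_nonneg _
    have hfac : 1 - (1 - ∑ e, p k e) * c / (6 * (n : ℝ) ^ 2) ≤
        Real.exp (-(h / (24 * (n : ℝ) ^ 2))) := by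
      refine le_trans ?_ (Real.one_sub_le_exp_neg _)
      have : h / (24 * (n : ℝ) ^ 2) = h / 4 / (6 * (n : ℝ) ^ 2) := by
        rw [div_div]; ring_nf
      rw [this]
      gcongr
    calc _ ≤ _ := hmono.trans hstep
      _ ≤ Real.exp (-(h / (24 * (n : ℝ) ^ 2))) *
          ((n : ℝ) ^ 2 * Real.exp (-(h / (24 * (n : ℝ) ^ 2) * k))) := by gcongr
      _ = _ := by
        rw [mul_left_comm, ← Real.exp_add]
        congr 2
        push_cast
        ring

/-- The difference of the largest and the smallest value. -/
def spread (y : Fin n → ℤ) : ℤ := (⨆ i, y i) - ⨅ i, y i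

lemma exists_extremes [Nonempty (Fin n)] (y : Fin n → ℤ) :
    ∃ a b, y ∈ box n (y b) (y a) ∧ spread y = y a - y b := by
  obtain ⟨a, ha⟩ := exists_eq_ciSup_of_finite (f := y)
  obtain ⟨b, hb⟩ := exists_eq_ciInf_of_finite (f := y)
  refine ⟨a, b, fun i => ⟨?_, ?_⟩, ?_⟩
  · rw [hb]; exact ciInf_le (Set.finite_range y).bddBelow i
  · rw [ha]; exact le_ciSup (Set.finite_range y).bddAbove i
  · rw [ha, hb, spread]

/-- The excess of the spread over `1`. -/
def excess (y : Fin n → ℤ) : ℝ := ((max (spread y - 1) 0 : ℤ) : ℝ)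

/-- The indicator of the event that two values differ by at least `2`. -/
def wide (y : Fin n → ℤ) : ℝ := if 2 ≤ spread y then 1 else 0

lemma excess_nonneg (y : Fin n → ℤ) : 0 ≤ excess y := by
  unfold excess; exact_mod_cast le_max_right _ _

/-- After `k` steps of length `h` the expected excess has decreased by `1 / 2`, provided that
`h * k` is large compared to `n ^ 2 * log n`. -/
lemma evolve_excess_le [Nonempty (Fin n)] {h : ℝ} {p : ℕ → Sym2 (Fin n) → ℝ}
    (hp : HasRates h p) (k : ℕ) (hk : 48 * (n : ℝ) ^ 2 * Real.log (2 * (n : ℝ) ^ 2) ≤ h * k)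
    (y : Fin n → ℤ) : evolve p k excess y ≤ excess y - 1 / 2 * wide y := by
  obtain ⟨a₀, b₀, hy, hspread⟩ := exists_extremes y
  set M := y a₀
  set m := y b₀
  have hsub : ∀ z ∈ box n m M, spread z ≤ M - m ∧
      (spread z = M - m → ∃ a b, z a = M ∧ z b = m) := by
    intro z hz
    obtain ⟨a, b, _, hs⟩ := exists_extremes z
    have ha := hz a
    have hb := hz b
    exact ⟨by omega, fun h => ⟨a, b, by omega, by omega⟩⟩
  by_cases hw : 2 ≤ spread y
  -- Within the box the excess stays undiminished only if both `M` and `m` are still present, and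
  -- then some extreme pair contributes `1`.
  · have hbound : ∀ z ∈ box n m M, excess z ≤ ((fun _ => excess y - 1) +
        ∑ a, ∑ b, extremePair M m a b : (Fin n → ℤ) → ℝ) z := by
      intro z hz
      obtain ⟨h1, h2⟩ := hsub z hz
      have hnn : ∀ a b, 0 ≤ extremePair M m a b z := fun a b => by
        unfold extremePair; split_ifs <;> norm_num
      simp only [Pi.add_apply, Finset.sum_apply]
      by_cases heq : spread z = M - m
      · obtain ⟨a, b, ha, hb⟩ := h2 heq
        have h3 : (1 : ℝ) ≤ ∑ a, ∑ b, extremePair M m a b z := by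
          calc (1 : ℝ) = extremePair M m a b z := by simp [extremePair, ha, hb]
            _ ≤ ∑ b, extremePair M m a b z :=
              Finset.single_le_sum (f := fun b => extremePair M m a b z)
                (fun b _ => hnn a b) (Finset.mem_univ b)
            _ ≤ _ := Finset.single_le_sum (f := fun a => ∑ b, extremePair M m a b z)
                (fun a _ => Finset.sum_nonneg fun b _ => hnn a b) (Finset.mem_univ a)
        have h4 : excess z = excess y := by unfold excess; rw [heq, hspread]
        linarith
      · have h3 : (0 : ℝ) ≤ ∑ a, ∑ b, extremePair M m a b z :=
          Finset.sum_nonneg fun a _ => Finset.sum_nonneg fun b _ => hnn a b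
        have h4 : excess z ≤ excess y - 1 := by
          have : max (spread z - 1) 0 ≤ max (spread y - 1) 0 - 1 := by omega
          unfold excess
          exact_mod_cast this
        linarith
    have h1 := evolve_box_mono hp.isSubprob k hbound y hy
    rw [map_add, evolve_const] at h1
    simp only [map_sum, Pi.add_apply, Finset.sum_apply] at h1
    have h2 := sum_sq_evolve_extremePair_le hp (by omega : m + 2 ≤ M) k hy
    set u : Fin n → Fin n → ℝ := fun a b => evolve p k (extremePair M m a b) y
    have h3 : (∑ a, ∑ b, u a b) ^ 2 ≤ (n : ℝ) ^ 2 * ∑ a, ∑ b, u a b ^ 2 := by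
      have := sq_sum_le_card_mul_sum_sq (s := (Finset.univ : Finset (Fin n × Fin n)))
        (f := fun x => u x.1 x.2)
      rw [Fintype.sum_prod_type, Fintype.sum_prod_type] at this
      simpa [sq] using this
    have hn : (0 : ℝ) < n := by exact_mod_cast Fin.pos_iff_nonempty.2 ‹_›
    -- The constant `48 = 2 * 24` supplies the square, which beats the factor `n² * n²` from
    -- Cauchy–Schwarz and the initial norm and leaves `1 / 4`.
    have h4 : Real.exp (-(h / (24 * (n : ℝ) ^ 2) * k)) ≤ (1 / (2 * (n : ℝ) ^ 2)) ^ 2 := by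
      have h5 : (1 / (2 * (n : ℝ) ^ 2)) ^ 2 =
          Real.exp (-(2 * Real.log (2 * (n : ℝ) ^ 2))) := by
        rw [Real.exp_neg, two_mul (Real.log _), Real.exp_add, Real.exp_log (by positivity)]
        field_simp
      rw [h5, Real.exp_le_exp, neg_le_neg_iff, div_mul_eq_mul_div, le_div_iff₀ (by positivity)]
      linarith
    have h5 : (∑ a, ∑ b, u a b) ^ 2 ≤ (1 / 2) ^ 2 := by
      calc _ ≤ (n : ℝ) ^ 2 * ((n : ℝ) ^ 2 * (1 / (2 * (n : ℝ) ^ 2)) ^ 2) := by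
            refine h3.trans ?_
            gcongr
            exact h2.trans (by gcongr)
        _ = _ := by field_simp
    have h6 := abs_le_of_sq_le_sq h5 (by norm_num)
    rw [wide, if_pos hw]
    linarith [(le_abs_self _).trans h6]
  · have h1 := evolve_box_mono hp.isSubprob k (f := excess) (g := fun _ => excess y)
      (fun z hz => by
        have h2 := (hsub z hz).1
        have : max (spread z - 1) 0 ≤ max (spread y - 1) 0 := by omega
        unfold excess
        exact_mod_cast this) y hy
    rw [evolve_const] at h1
    rw [wide, if_neg hw]
    linarith

/-- The expected number of multiples of `k` at which the chain is wide. -/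
lemma sum_evolve_wide_le [Nonempty (Fin n)] {h : ℝ} {p : ℕ → Sym2 (Fin n) → ℝ}
    (hp : HasRates h p) (k : ℕ) (hk : 48 * (n : ℝ) ^ 2 * Real.log (2 * (n : ℝ) ^ 2) ≤ h * k)
    (y : Fin n → ℤ) (r : ℕ) :
    ∑ i ∈ Finset.range r, evolve p (i * k) wide y ≤ 2 * excess y := by
  have hmono : ∀ (i : ℕ) {f g : (Fin n → ℤ) → ℝ}, (∀ z, f z ≤ g z) →
      evolve p i f y ≤ evolve p i g y := fun i f g hfg =>
    evolve_mono hp.isSubprob (S := Set.univ) (fun _ _ _ => trivial) i (fun z _ => hfg z) y trivial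
  have hstep : ∀ r : ℕ, 1 / 2 * ∑ i ∈ Finset.range r, evolve p (i * k) wide y ≤
      excess y - evolve p (r * k) excess y := by
    intro r
    induction r with
    | zero => simp [evolve]
    | succ r ih =>
      -- Markov property at step `r * k`: the one-block drift holds from every state, with the
      -- shifted activation probabilities.
      have h1 : evolve p ((r + 1) * k) excess y ≤
          evolve p (r * k) (excess - (1 / 2 : ℝ) • wide) y := by
        rw [Nat.succ_mul, evolve_add]
        refine hmono _ fun z => ?_
        simpa using evolve_excess_le (hp.shift (r * k)) k hk z
      rw [map_sub, map_smul] at h1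
      simp only [Pi.sub_apply, Pi.smul_apply, smul_eq_mul] at h1
      rw [Finset.sum_range_succ]
      linarith
  have h0 : 0 ≤ evolve p (r * k) excess y := by
    have := hmono (r * k) (f := fun _ => 0) (g := excess) excess_nonneg
    rwa [evolve_const] at this
  linarith [hstep r]

/-- A state with the right sum whose values differ by at most `1` is in the consensus set. -/
lemma mem_consensusSet [Nonempty (Fin n)] {x₀ y : Fin n → ℤ} (hsum : ∑ i, y i = ∑ i, x₀ i)
    (hy : ¬ 2 ≤ spread y) : y ∈ consensusSet x₀ := by
  have hn : (0 : ℝ) < n := by exact_mod_cast Fin.pos_iff_nonempty.2 ‹_›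
  have havg : average y = average x₀ := by
    unfold average
    congr 1
    exact_mod_cast hsum
  obtain ⟨a, b, hbox, hs⟩ := exists_extremes y
  have hfloor : ⌊average x₀⌋ = y b := by
    rw [← havg, Int.floor_eq_iff, average, le_div_iff₀ hn, div_lt_iff₀ hn]
    constructor
    · have : ∑ _i : Fin n, (y b : ℝ) ≤ ∑ i, (y i : ℝ) :=
        Finset.sum_le_sum fun i _ => by exact_mod_cast (hbox i).1
      simpa [mul_comm] using this
    -- Strict because the minimizer `b` itself lies below `y b + 1`.
    · have : ∑ i, (y i : ℝ) < ∑ _i : Fin n, ((y b : ℝ) + 1) := by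
        refine Finset.sum_lt_sum (fun i _ => ?_) ⟨b, Finset.mem_univ b, by linarith⟩
        have h1 := (hbox i).2
        have : y i ≤ y b + 1 := by omega
        exact_mod_cast this
      simpa [mul_comm, mul_add] using this
  refine ⟨fun i => ?_, havg⟩
  rw [hfloor]
  have := hbox i
  omega

/-! ### Trajectories on a time grid -/

/-- The update by the numbers `z` of arrivals in a time cell: it is the update at `e` if there is
exactly one arrival, at `e`, and it is trivial otherwise. -/
def fire (z : Sym2 (Fin n) → ℕ) (y : Fin n → ℤ) : Fin n → ℤ :=
  open Classical in
  if h : ∃ e, z = Pi.single e 1 then update h.choose y else y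

lemma single_one_injective {α : Type*} [DecidableEq α] :
    Function.Injective fun e : α => (Pi.single e 1 : α → ℕ) := by
  intro e e' h
  by_contra hne
  have := congrFun h e
  simp [hne] at this

lemma fire_single (e : Sym2 (Fin n)) (y : Fin n → ℤ) : fire (Pi.single e 1) y = update e y := by
  have h : ∃ e', (Pi.single e 1 : Sym2 (Fin n) → ℕ) = Pi.single e' 1 := ⟨e, rfl⟩
  rw [fire, dif_pos h]
  congr 1
  exact (single_one_injective h.choose_spec).symm

lemma fire_of_forall_ne {z : Sym2 (Fin n) → ℕ} (hz : ∀ e, z ≠ Pi.single e 1) (y : Fin n → ℤ) :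
    fire z y = y :=
  dif_neg fun ⟨e, he⟩ => hz e he

/-- The trajectory from `x₀` driven by the numbers of arrivals in the successive time cells. -/
def traj (x₀ : Fin n → ℤ) (z : ℕ → Sym2 (Fin n) → ℕ) : ℕ → Fin n → ℤ
  | 0 => x₀
  | j + 1 => fire (z j) (traj x₀ z j)

lemma traj_congr (x₀ : Fin n → ℤ) {z z' : ℕ → Sym2 (Fin n) → ℕ} (j : ℕ)
    (h : ∀ i < j, z i = z' i) : traj x₀ z j = traj x₀ z' j := by
  induction j with
  | zero => rfl
  | succ j ih =>
    rw [traj, traj, ih fun i hi => h i (by omega), h j (by omega)]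

lemma traj_invariant {x₀ : Fin n → ℤ} {S : Set (Fin n → ℤ)} (hx : x₀ ∈ S)
    (hS : ∀ e, ∀ y ∈ S, update e y ∈ S) (z : ℕ → Sym2 (Fin n) → ℕ) (j : ℕ) :
    traj x₀ z j ∈ S := by
  induction j with
  | zero => exact hx
  | succ j ih =>
    rw [traj]
    by_cases h : ∃ e, z j = Pi.single e 1
    · obtain ⟨e, he⟩ := h
      rw [he, fire_single]
      exact hS e _ ih
    · rw [fire_of_forall_ne (by simpa using h)]
      exact ih

lemma box_finite (m M : ℤ) : (box n m M).Finite := by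
  have : box n m M = Set.Icc (fun _ => m) (fun _ => M) := by
    ext y
    simp [box, Pi.le_def, forall_and]
  rw [this]
  exact Set.finite_Icc _ _

variable {Ω : Type*}

/-- The `j`-th time of the grid of mesh `1 / K`. -/
def gridTime (K j : ℕ) : ℝ≥0 := (j : ℝ≥0) / K

lemma gridTime_mono (K : ℕ) : Monotone (gridTime K) := by
  intro i j hij
  unfold gridTime
  gcongr

/-- The numbers of arrivals in the `j`-th cell of the grid of mesh `1 / K`. -/
def cellCount (N : Sym2 (Fin n) → ℝ≥0 → Ω → ℕ) (K j : ℕ) (ω : Ω) (e : Sym2 (Fin n)) : ℕ :=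
  N e (gridTime K (j + 1)) ω - N e (gridTime K j) ω

/-- Off the cells with several arrivals, the driven path coincides with the trajectory. -/
lemma IsDrivenPath.eq_traj {N : Sym2 (Fin n) → ℝ≥0 → Ω → ℕ} {ω : Ω} {x₀ : Fin n → ℤ}
    {x : ℝ≥0 → Fin n → ℤ} (hx : IsDrivenPath (fun e t => N e t ω) x₀ x)
    (hN : ∀ e, Monotone fun t => N e t ω) (K j : ℕ)
    (hgood : ∀ i < j, cellCount N K i ω = 0 ∨ ∃ e, cellCount N K i ω = Pi.single e 1) :
    x (gridTime K j) = traj x₀ (fun i => cellCount N K i ω) j := by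
  induction j with
  | zero => simpa [gridTime, traj] using hx.initial
  | succ j ih =>
    have ih' := ih fun i hi => hgood i (by omega)
    have hle := gridTime_mono K (Nat.le_succ j)
    have hNle : ∀ e, N e (gridTime K j) ω ≤ N e (gridTime K (j + 1)) ω := fun e => hN e hle
    rw [traj, ← ih']
    rcases hgood j (by omega) with h0 | ⟨e, he⟩
    · rw [fire_of_forall_ne]
      · refine hx.no_arrival _ _ hle fun e => ?_
        have := congrFun h0 e
        have h2 := hNle e
        simp only [cellCount, Pi.zero_apply] at this
        omega
      · intro e h
        have := congrFun (h0.symm.trans h) e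
        simp at this
    · rw [he, fire_single]
      refine hx.one_arrival _ _ e hle ?_ fun e' he' => ?_
      · have := congrFun he e
        have h2 := hNle e
        simp only [cellCount, Pi.single_eq_same] at this
        omega
      · have := congrFun he e'
        have h2 := hNle e'
        simp only [cellCount, Pi.single_eq_of_ne he'] at this
        omega

variable [MeasurableSpace Ω] {P : Measure Ω}

lemma AreMetropolisClocks.measurable_cellCount {G : ℕ → SimpleGraph (Fin n)}
    {N : Sym2 (Fin n) → ℝ≥0 → Ω → ℕ} (hN : AreMetropolisClocks P G N) (K j : ℕ)
    (e : Sym2 (Fin n)) : Measurable fun ω => cellCount N K j ω e :=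
  ((hN.poisson e).measurable _).sub ((hN.poisson e).measurable _)

lemma AreMetropolisClocks.iIndepFun_cellCount {G : ℕ → SimpleGraph (Fin n)}
    {N : Sym2 (Fin n) → ℝ≥0 → Ω → ℕ} (hN : AreMetropolisClocks P G N) (K : ℕ) :
    iIndepFun (fun (q : Sym2 (Fin n) × ℕ) ω => cellCount N K q.2 ω q.1) P := by
  refine iIndepFun_uncurry' (X := fun e j ω => cellCount N K j ω e)
    (fun e j => hN.measurable_cellCount K j e) ?_ fun e => ?_
  · exact hN.indep.comp (fun _ path j => path (gridTime K (j + 1)) - path (gridTime K j))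
      fun e => measurable_pi_lambda _ fun j => (measurable_pi_apply _).sub (measurable_pi_apply _)
  · exact (hN.poisson e).indep_increments.nat (gridTime_mono K)

/-- If the arrivals in the time cells are independent, then the expectations along the trajectory
are given by the transition operators. -/
theorem integral_traj [IsProbabilityMeasure P] {z : ℕ → Ω → Sym2 (Fin n) → ℕ}
    (hz : ∀ j e, Measurable fun ω => z j ω e)
    (hind : iIndepFun (fun (q : Sym2 (Fin n) × ℕ) ω => z q.2 ω q.1) P) (x₀ : Fin n → ℤ) (j : ℕ)
    (f : (Fin n → ℤ) → ℝ) :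
    ∫ ω, f (traj x₀ (fun i => z i ω) j) ∂P =
      evolve (fun i e => P.real {ω | z i ω = Pi.single e 1}) j f x₀ := by
  induction j generalizing f with
  | zero => simp [traj, evolve]
  | succ j ih =>
    set Y : Ω → Fin n → ℤ := fun ω => traj x₀ (fun i => z i ω) j with hY
    set S : Finset (Sym2 (Fin n) × ℕ) := Finset.univ ×ˢ Finset.range j
    set T : Finset (Sym2 (Fin n) × ℕ) := Finset.univ ×ˢ {j}
    have hST : Disjoint S T := by
      rw [Finset.disjoint_left]
      intro q hq hq'
      simp only [S, T, Finset.mem_product, Finset.mem_range, Finset.mem_singleton] at hq hq'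
      omega
    have hcell : ∀ q : Sym2 (Fin n) × ℕ, Measurable fun ω => z q.2 ω q.1 := fun q => hz q.2 q.1
    have hpair := hind.indepFun_finset S T hST hcell
    -- The state at step `j` is a function of the finitely many earlier counts; the filler `0` is
    -- irrelevant by `traj_congr`.
    let φ : (S → ℕ) → Fin n → ℤ := fun v => traj x₀
      (fun i e => if h : (e, i) ∈ S then v ⟨(e, i), h⟩ else 0) j
    let ψ : (T → ℕ) → Sym2 (Fin n) → ℕ := fun v e => v ⟨(e, j), by simp [T]⟩
    have hφ : φ ∘ (fun ω (q : S) => z q.1.2 ω q.1.1) = Y := by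
      funext ω
      refine traj_congr x₀ j fun i hi => ?_
      funext e
      have : (e, i) ∈ S := by simp [S, hi]
      simp [this]
    have hYz : IndepFun Y (z j) P := by
      have := hpair.comp (measurable_of_countable φ) (measurable_of_countable ψ)
      rwa [hφ] at this
    have hYm : Measurable Y := by
      rw [← hφ]
      exact (measurable_of_countable φ).comp (measurable_pi_lambda _ fun q => hcell q)
    have hzm : Measurable (z j) := measurable_pi_lambda _ (hz j)
    -- The trajectory stays in a finite box, on which every function is bounded.
    have hint : ∀ g : (Fin n → ℤ) → ℝ, Integrable (fun ω => g (Y ω)) P := by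
      intro g
      obtain ⟨C, hC⟩ : ∃ C, ∀ y ∈ box n (⨅ i, x₀ i) (⨆ i, x₀ i), ‖g y‖ ≤ C := by
        obtain ⟨C, hC⟩ := ((box_finite (n := n) (⨅ i, x₀ i) (⨆ i, x₀ i)).image
          fun y => ‖g y‖).bddAbove
        exact ⟨C, fun y hy => hC ⟨y, hy, rfl⟩⟩
      refine Integrable.of_bound ((measurable_of_countable g).comp hYm).aestronglyMeasurable C
        (Filter.Eventually.of_forall fun ω => hC _ ?_)
      exact traj_invariant (S := box n _ _) (fun i => ⟨ciInf_le (Set.finite_range x₀).bddBelow i,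
        le_ciSup (Set.finite_range x₀).bddAbove i⟩) (fun e _ => update_mem_box e) _ j
    let ι : Sym2 (Fin n) → (Sym2 (Fin n) → ℕ) → ℝ :=
      fun e => Set.indicator {Pi.single e 1} fun _ => 1
    have hpt : ∀ ω, f (traj x₀ (fun i => z i ω) (j + 1)) =
        f (Y ω) + ∑ e, ι e (z j ω) * (f (update e (Y ω)) - f (Y ω)) := by
      intro ω
      change f (fire (z j ω) (Y ω)) = _
      by_cases h : ∃ e, z j ω = Pi.single e 1
      · obtain ⟨e, he⟩ := h
        rw [he, fire_single, Finset.sum_eq_single e]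
        · simp [ι]
        · intro e' _ hne
          have : (Pi.single e 1 : Sym2 (Fin n) → ℕ) ≠ Pi.single e' 1 :=
            fun h => hne (single_one_injective h).symm
          simp [ι, this]
        · simp
      · have h' : ∀ e, z j ω ≠ Pi.single e 1 := by simpa using h
        rw [fire_of_forall_ne h']
        simp [ι, h']
    have hι : ∀ e, ∫ ω, ι e (z j ω) ∂P = P.real {ω | z j ω = Pi.single e 1} := by
      intro e
      have hE : MeasurableSet {ω | z j ω = Pi.single e 1} := hzm (MeasurableSet.singleton _)
      rw [← integral_indicator_one hE]
      rfl
    have hprod : ∀ e, ∫ ω, ι e (z j ω) * (f (update e (Y ω)) - f (Y ω)) ∂P =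
        P.real {ω | z j ω = Pi.single e 1} *
          (∫ ω, f (update e (Y ω)) ∂P - ∫ ω, f (Y ω) ∂P) := by
      intro e
      rw [hYz.symm.integral_fun_comp_mul_comp (f := ι e)
        (g := fun y => f (update e y) - f y) hzm.aemeasurable hYm.aemeasurable
        (measurable_of_countable _).aestronglyMeasurable
        (measurable_of_countable _).aestronglyMeasurable, hι,
        integral_sub (hint fun y => f (update e y)) (hint f)]
    have hprodint : ∀ e ∈ (Finset.univ : Finset (Sym2 (Fin n))),
        Integrable (fun ω => ι e (z j ω) * (f (update e (Y ω)) - f (Y ω))) P := by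
      intro e _
      refine (hint fun y => f (update e y) - f y).bdd_mul (c := 1)
        ((measurable_of_countable (ι e)).comp hzm).aestronglyMeasurable
        (Filter.Eventually.of_forall fun ω => ?_)
      simp only [ι, Set.indicator]
      split_ifs <;> simp
    simp_rw [hpt]
    rw [integral_add (hint f) (integrable_finsetSum _ hprodint),
      integral_finsetSum _ hprodint, evolve_succ, ← ih]
    simp_rw [hprod, stepOp_apply]
    rw [integral_add ((hint f).const_mul _) (integrable_finsetSum _ fun e _ =>
      (hint fun y => f (update e y)).const_mul _), integral_finsetSum _ fun e _ =>
      (hint fun y => f (update e y)).const_mul _]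
    simp_rw [integral_const_mul, mul_sub, Finset.sum_sub_distrib, ← Finset.sum_mul]
    ring

/-! ### Arrival probabilities in a cell -/

section Clocks

variable {G : ℕ → SimpleGraph (Fin n)} {N : Sym2 (Fin n) → ℝ≥0 → Ω → ℕ}

lemma integral_clockRate_cell (G : ℕ → SimpleGraph (Fin n)) (e : Sym2 (Fin n)) {K : ℕ}
    (hK : 0 < K) (j : ℕ) :
    ∫ u in (gridTime K j : ℝ)..(gridTime K (j + 1) : ℝ), clockRate (G ⌊u⌋₊) e =
      1 / K * clockRate (G (j / K)) e := by
  have hK' : (0 : ℝ) < K := by exact_mod_cast hK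
  have hs : (gridTime K j : ℝ) = j / K := by simp [gridTime]
  have ht : (gridTime K (j + 1) : ℝ) = (j + 1) / K := by simp [gridTime]
  have hle : (j : ℝ) / K ≤ (j + 1) / K := by gcongr; linarith
  rw [hs, ht]
  have hcongr : ∫ u in ((j : ℝ) / K)..((j + 1 : ℝ) / K), clockRate (G ⌊u⌋₊) e =
      ∫ _ in ((j : ℝ) / K)..((j + 1 : ℝ) / K), clockRate (G (j / K)) e := by
    refine intervalIntegral.integral_congr_ae ?_
    -- The graph may switch at the right endpoint of the cell; the cells refine the unit intervals,
    -- so it is constant in the interior.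
    have hne : ∀ᵐ u : ℝ, u ≠ (j + 1 : ℝ) / K := by
      simp [ae_iff]
    filter_upwards [hne] with u hu hmem
    rw [Set.uIoc_of_le hle] at hmem
    have hlt : u < (j + 1 : ℝ) / K := lt_of_le_of_ne hmem.2 hu
    have hfloor : ⌊u⌋₊ = j / K := by
      have hu0 : 0 ≤ u := le_trans (by positivity) hmem.1.le
      rw [Nat.floor_eq_iff hu0]
      constructor
      · refine le_trans ?_ hmem.1.le
        rw [le_div_iff₀ hK']
        exact_mod_cast Nat.div_mul_le_self j K
      · refine hlt.trans_le ?_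
        rw [div_le_iff₀ hK']
        have : j + 1 ≤ (j / K + 1) * K := by
          rw [Nat.add_one_le_iff, mul_comm]
          exact Nat.lt_mul_div_succ j hK
        exact_mod_cast this
    rw [hfloor]
  rw [hcongr, intervalIntegral.integral_const, smul_eq_mul]
  congr 1
  field_simp
  ring

/-- The arrivals in a cell are independent Poisson variables. -/
lemma AreMetropolisClocks.measureReal_cellCount_eq (hN : AreMetropolisClocks P G N) {K : ℕ}
    (hK : 0 < K) (j : ℕ) (v : Sym2 (Fin n) → ℕ) :
    P.real {ω | cellCount N K j ω = v} = ∏ e, Real.exp (-(posRate (G (j / K)) e / K)) *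
      (posRate (G (j / K)) e / K) ^ v e / (v e).factorial := by
  have hind : iIndepFun (fun e ω => cellCount N K j ω e) P :=
    (hN.iIndepFun_cellCount K).precomp (g := fun e => (e, j)) fun e e' h => (Prod.ext_iff.1 h).1
  have hset : {ω | cellCount N K j ω = v} =
      ⋂ e ∈ Finset.univ, (fun ω => cellCount N K j ω e) ⁻¹' {v e} := by
    ext ω
    simp [funext_iff]
  rw [hset, measureReal_def, hind.measure_inter_preimage_eq_mul Finset.univ
    (sets := fun e => {v e}) fun e _ => MeasurableSet.singleton _, ENNReal.toReal_prod]
  refine Finset.prod_congr rfl fun e _ => ?_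
  have hlaw := (hN.poisson e).law_increments _ _ (gridTime_mono K (Nat.le_succ j))
  have h1 := hlaw.measureReal_eq (p := fun k => k = v e) (MeasurableSet.singleton _)
  -- The truncation in `posRate` matches `Real.toNNReal` in the law of the increments, so the sign
  -- of the loop rates plays no role.
  have h2 : ((Real.toNNReal (∫ u in (gridTime K j : ℝ)..(gridTime K (j + 1) : ℝ),
      clockRate (G ⌊u⌋₊) e) : ℝ≥0) : ℝ) = posRate (G (j / K)) e / K := by
    rw [integral_clockRate_cell G e hK j, Real.coe_toNNReal', posRate, one_div, div_eq_inv_mul,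
      mul_max_of_nonneg _ _ (by positivity), mul_zero]
  have h3 := poissonMeasure_real_singleton (Real.toNNReal (∫ u in
    (gridTime K j : ℝ)..(gridTime K (j + 1) : ℝ), clockRate (G ⌊u⌋₊) e)) (v e)
  rw [h2] at h3
  rw [← h3]
  exact h1

/-- The expected number of arrivals in the `j`-th cell. -/
def cellMass (G : ℕ → SimpleGraph (Fin n)) (K j : ℕ) : ℝ := ∑ e, posRate (G (j / K)) e / K

lemma cellMass_nonneg (G : ℕ → SimpleGraph (Fin n)) (K j : ℕ) : 0 ≤ cellMass G K j :=
  Finset.sum_nonneg fun e _ => div_nonneg (posRate_nonneg _ e) (Nat.cast_nonneg K)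

lemma cellMass_le (G : ℕ → SimpleGraph (Fin n)) (K j : ℕ) :
    cellMass G K j ≤ Fintype.card (Sym2 (Fin n)) / K := by
  unfold cellMass
  rw [← Finset.sum_div]
  gcongr
  refine (Finset.sum_le_sum fun e _ => posRate_le_one (G (j / K)) e).trans ?_
  simp

lemma AreMetropolisClocks.measureReal_cellCount_zero (hN : AreMetropolisClocks P G N) {K : ℕ}
    (hK : 0 < K) (j : ℕ) :
    P.real {ω | cellCount N K j ω = 0} = Real.exp (-cellMass G K j) := by
  rw [hN.measureReal_cellCount_eq hK, cellMass, ← Finset.sum_neg_distrib, Real.exp_sum]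
  simp

lemma AreMetropolisClocks.measureReal_cellCount_single (hN : AreMetropolisClocks P G N) {K : ℕ}
    (hK : 0 < K) (j : ℕ) (e : Sym2 (Fin n)) :
    P.real {ω | cellCount N K j ω = Pi.single e 1} =
      posRate (G (j / K)) e / K * Real.exp (-cellMass G K j) := by
  rw [hN.measureReal_cellCount_eq hK, cellMass, ← Finset.sum_neg_distrib, Real.exp_sum]
  simp_rw [mul_div_assoc]
  rw [Finset.prod_mul_distrib, mul_comm]
  congr 1
  rw [Finset.prod_eq_single e]
  · simp
  · intro e' _ he'
    simp [Pi.single_eq_of_ne he']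
  · simp

lemma AreMetropolisClocks.sum_measureReal_cellCount_single (hN : AreMetropolisClocks P G N)
    {K : ℕ} (hK : 0 < K) (j : ℕ) :
    ∑ e, P.real {ω | cellCount N K j ω = Pi.single e 1} =
      cellMass G K j * Real.exp (-cellMass G K j) := by
  simp_rw [hN.measureReal_cellCount_single hK, ← Finset.sum_mul]
  rfl

/-- A fine grid makes the cell mass at most `1 / 4`, so both the holding probability and the factor
`exp (-mass)` are at least `3 / 4`, and `9 / 16 ≥ 1 / 4`. -/
lemma AreMetropolisClocks.hasRates (hN : AreMetropolisClocks P G N)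
    (hG : ∀ k, (G k).Connected) {K : ℕ} (hK : 0 < K)
    (hcard : 4 * Fintype.card (Sym2 (Fin n)) ≤ K) :
    HasRates (1 / K : ℝ) fun j e => P.real {ω | cellCount N K j ω = Pi.single e 1} := by
  intro j
  have hK' : (0 : ℝ) < K := by exact_mod_cast hK
  have h0 := cellMass_nonneg G K j
  have h1 : cellMass G K j ≤ 1 / 4 := by
    refine (cellMass_le G K j).trans ?_
    rw [div_le_iff₀ hK']
    have : (4 * Fintype.card (Sym2 (Fin n)) : ℝ) ≤ K := by exact_mod_cast hcard
    linarith
  have h2 := Real.one_sub_le_exp_neg (cellMass G K j)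
  have h3 : Real.exp (-cellMass G K j) ≤ 1 := Real.exp_le_one_iff.2 (by linarith)
  have h4 : cellMass G K j * Real.exp (-cellMass G K j) ≤ 1 / 4 := by nlinarith
  refine ⟨G (j / K), hG _, 1 / K * Real.exp (-cellMass G K j), by positivity, fun e => ?_, ?_, ?_⟩
  · refine le_of_eq ?_
    dsimp only
    rw [hN.measureReal_cellCount_single hK]
    ring
  · rw [hN.sum_measureReal_cellCount_single hK]
    linarith
  · rw [hN.sum_measureReal_cellCount_single hK]
    have h5 : 1 / 4 ≤ (1 - cellMass G K j * Real.exp (-cellMass G K j)) *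
        Real.exp (-cellMass G K j) := by nlinarith
    calc (1 / K : ℝ) / 4 = 1 / K * (1 / 4) := by ring
      _ ≤ 1 / K * ((1 - cellMass G K j * Real.exp (-cellMass G K j)) *
        Real.exp (-cellMass G K j)) := by gcongr
      _ = _ := by ring

variable [IsProbabilityMeasure P]

/-- Several arrivals in one cell are unlikely. -/
lemma AreMetropolisClocks.measureReal_several_le (hN : AreMetropolisClocks P G N) {K : ℕ}
    (hK : 0 < K) (j : ℕ) :
    P.real {ω | ¬ (cellCount N K j ω = 0 ∨ ∃ e, cellCount N K j ω = Pi.single e 1)} ≤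
      (Fintype.card (Sym2 (Fin n)) / K : ℝ) ^ 2 := by
  classical
  have hzm : Measurable (cellCount N K j) :=
    measurable_pi_lambda _ (hN.measurable_cellCount K j)
  set F : Finset (Sym2 (Fin n) → ℕ) :=
    insert 0 (Finset.univ.image fun e => (Pi.single e 1 : Sym2 (Fin n) → ℕ))
  have hset : {ω | ¬ (cellCount N K j ω = 0 ∨ ∃ e, cellCount N K j ω = Pi.single e 1)} =
      (cellCount N K j ⁻¹' (F : Set (Sym2 (Fin n) → ℕ)))ᶜ := by
    ext ω
    simp [F, eq_comm]
  have h0 : (0 : Sym2 (Fin n) → ℕ) ∉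
      Finset.univ.image fun e => (Pi.single e 1 : Sym2 (Fin n) → ℕ) := by
    simp
  have hF : P.real (cellCount N K j ⁻¹' (F : Set (Sym2 (Fin n) → ℕ))) =
      (1 + cellMass G K j) * Real.exp (-cellMass G K j) := by
    rw [← sum_measureReal_preimage_singleton F fun v _ => hzm (MeasurableSet.singleton v),
      Finset.sum_insert h0, Finset.sum_image fun e _ e' _ h => single_one_injective h, add_mul,
      one_mul, ← hN.sum_measureReal_cellCount_single hK j, ← hN.measureReal_cellCount_zero hK j]
    rfl
  rw [hset, probReal_compl_eq_one_sub (hzm F.measurableSet), hF]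
  have h1 := cellMass_nonneg G K j
  have h2 := Real.one_sub_le_exp_neg (cellMass G K j)
  -- With mass `μ`, `1 - (1 + μ) exp (-μ) ≤ 1 - (1 + μ) (1 - μ) = μ²`.
  calc _ ≤ cellMass G K j ^ 2 := by nlinarith
    _ ≤ _ := pow_le_pow_left₀ h1 (cellMass_le G K j) 2

end Clocks

/-- The probability of no consensus at a grid time is bounded by that of the trajectory. -/
lemma IsQuantizedMetropolis.measureReal_notMem_consensusSet_le [Nonempty (Fin n)]
    [IsProbabilityMeasure P]
    {G : ℕ → SimpleGraph (Fin n)} {N : Sym2 (Fin n) → ℝ≥0 → Ω → ℕ} {x₀ : Fin n → ℤ}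
    {X : ℝ≥0 → Ω → Fin n → ℤ} (hX : IsQuantizedMetropolis P G N x₀ X) {K : ℕ} (hK : 0 < K)
    (j : ℕ) :
    P.real {ω | X (gridTime K j) ω ∉ consensusSet x₀} ≤
      evolve (fun i e => P.real {ω | cellCount N K i ω = Pi.single e 1}) j wide x₀ +
        j * (Fintype.card (Sym2 (Fin n)) / K : ℝ) ^ 2 := by
  have hz := hX.clocks.measurable_cellCount K
  rw [← integral_traj hz (hX.clocks.iIndepFun_cellCount K)]
  set W : Set Ω := {ω | 2 ≤ spread (traj x₀ (fun i => cellCount N K i ω) j)}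
  have hzm : ∀ i, Measurable (cellCount N K i) := fun i => measurable_pi_lambda _ (hz i)
  have hmeas : Measurable fun ω => traj x₀ (fun i => cellCount N K i ω) j := by
    have : ∀ j, Measurable fun ω => traj x₀ (fun i => cellCount N K i ω) j := by
      intro j
      induction j with
      | zero => exact measurable_const
      | succ j ih =>
        exact (measurable_of_countable fun q : (Sym2 (Fin n) → ℕ) × (Fin n → ℤ) =>
          fire q.1 q.2).comp ((hzm j).prodMk ih)
    exact this j
  have hW : MeasurableSet W := hmeas (Set.to_countable {y | 2 ≤ spread y}).measurableSet
  have hWint : ∫ ω, wide (traj x₀ (fun i => cellCount N K i ω) j) ∂P = P.real W := by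
    rw [← integral_indicator_one hW]
    refine integral_congr_ae (Filter.Eventually.of_forall fun ω => ?_)
    simp [wide, Set.indicator, W]
  set B : ℕ → Set Ω := fun i =>
    {ω | ¬ (cellCount N K i ω = 0 ∨ ∃ e, cellCount N K i ω = Pi.single e 1)}
  have hmono : ∀ᵐ ω ∂P, ∀ e, Monotone fun t => N e t ω :=
    ae_all_iff.2 fun e => (hX.clocks.poisson e).path.mono fun ω h => h.2.1
  have hsub : {ω | X (gridTime K j) ω ∉ consensusSet x₀} ≤ᵐ[P]
      (W ∪ ⋃ i ∈ Finset.range j, B i : Set Ω) := by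
    filter_upwards [hmono, hX.driven] with ω hω hdr hmem
    by_contra hcon
    have hcon' : ω ∉ W ∧ ∀ i < j, ω ∉ B i := by
      have h2 : ¬ (ω ∈ (W ∪ ⋃ i ∈ Finset.range j, B i : Set Ω)) := hcon
      simpa [not_or] using h2
    have heq := hdr.eq_traj hω K j fun i hi => not_not.1 (hcon'.2 i hi)
    refine hmem (mem_consensusSet ?_ ?_)
    · rw [heq]
      exact traj_invariant (S := {y | ∑ i, y i = ∑ i, x₀ i}) rfl
        (fun e y hy => (sum_update e y).trans hy) _ j
    · rw [heq]
      exact hcon'.1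
  have h1 : P.real {ω | X (gridTime K j) ω ∉ consensusSet x₀} ≤
      P.real (W ∪ ⋃ i ∈ Finset.range j, B i) :=
    ENNReal.toReal_mono (measure_ne_top _ _) (measure_mono_ae hsub)
  have h2 : P.real (⋃ i ∈ Finset.range j, B i) ≤ ∑ i ∈ Finset.range j, P.real (B i) :=
    measureReal_biUnion_finset_le _ _
  have h3 : ∑ i ∈ Finset.range j, P.real (B i) ≤
      j * (Fintype.card (Sym2 (Fin n)) / K : ℝ) ^ 2 := by
    refine (Finset.sum_le_sum fun i _ => hX.clocks.measureReal_several_le hK i).trans ?_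
    simp
  rw [hWint]
  linarith [measureReal_union_le (μ := P) W (⋃ i ∈ Finset.range j, B i)]

end

end QuantizedMetropolis

/-! ### From the grid to the expected hitting time -/

namespace QuantizedMetropolis

noncomputable section

variable {n : ℕ} {Ω : Type*} [MeasurableSpace Ω] {P : Measure Ω} [IsProbabilityMeasure P]

/-- The expected number of multiples of `τ` at which there is no consensus. -/
lemma IsQuantizedMetropolis.sum_measureReal_notMem_le {G : ℕ → SimpleGraph (Fin n)}
    (hG : ∀ k, (G k).Connected) {N : Sym2 (Fin n) → ℝ≥0 → Ω → ℕ} {x₀ : Fin n → ℤ}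
    {X : ℝ≥0 → Ω → Fin n → ℤ} (hX : IsQuantizedMetropolis P G N x₀ X) (τ : ℕ)
    (hτ : 48 * (n : ℝ) ^ 2 * Real.log (2 * (n : ℝ) ^ 2) ≤ τ) (r : ℕ) :
    ∑ i ∈ Finset.range r, P.real {ω | X (i * τ) ω ∉ consensusSet x₀} ≤ 2 * excess x₀ := by
  have : Nonempty (Fin n) := (hG 0).nonempty
  set B : ℝ := (Fintype.card (Sym2 (Fin n)) : ℝ)
  set D : ℝ := ∑ i ∈ Finset.range r, (i * τ * B ^ 2 : ℝ)
  -- Time `i * τ` is reached after `i * τ * K` cells, each bad with probability at most `(B / K)²`;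
  -- the total error `i * τ * B² / K` vanishes as `K → ∞`.
  have hlim : Filter.Tendsto (fun K : ℕ => 2 * excess x₀ + D / K) Filter.atTop
      (nhds (2 * excess x₀)) := by
    simpa using (tendsto_const_div_atTop_nhds_zero_nat D).const_add (2 * excess x₀)
  refine ge_of_tendsto hlim ?_
  filter_upwards [Filter.eventually_ge_atTop (max 1 (4 * Fintype.card (Sym2 (Fin n))))] with K hK
  have hK0 : 0 < K := lt_of_lt_of_le one_pos ((le_max_left _ _).trans hK)
  have hK' : (0 : ℝ) < K := by exact_mod_cast hK0
  have hrates := hX.clocks.hasRates hG hK0 ((le_max_right _ _).trans hK)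
  have h1 := sum_evolve_wide_le hrates (τ * K) (by
    refine hτ.trans (le_of_eq ?_)
    push_cast
    field_simp) x₀ r
  have h2 : ∀ i : ℕ, P.real {ω | X (i * τ) ω ∉ consensusSet x₀} ≤
      evolve (fun i e => P.real {ω | cellCount N K i ω = Pi.single e 1}) (i * (τ * K)) wide x₀ +
        i * τ * B ^ 2 / K := by
    intro i
    have h3 := hX.measureReal_notMem_consensusSet_le hK0 (i * (τ * K))
    have h4 : gridTime K (i * (τ * K)) = i * τ := by
      have : (K : ℝ≥0) ≠ 0 := by exact_mod_cast hK0.ne'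
      unfold gridTime
      push_cast
      field_simp
    rw [h4] at h3
    refine h3.trans (le_of_eq ?_)
    congr 1
    push_cast
    field_simp
    rfl
  refine (Finset.sum_le_sum fun i _ => h2 i).trans ?_
  rw [Finset.sum_add_distrib, ← Finset.sum_div]
  linarith

/-- A path hits `S` by `τ` times the number of multiples of `τ` at which it is not in `S`. -/
lemma hittingTime_le_tsum (x : ℝ≥0 → Fin n → ℤ) (S : Set (Fin n → ℤ)) {τ : ℕ} (hτ : 0 < τ) :
    hittingTime x S ≤ ∑' i : ℕ, τ * ({i : ℕ | x (i * τ) ∉ S}.indicator 1 i : ℝ≥0∞) := by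
  classical
  by_cases h : ∃ i : ℕ, x (i * τ) ∈ S
  · have hi := Nat.find_spec h
    set k := Nat.find h with hk
    calc hittingTime x S ≤ ((k * τ : ℝ≥0) : ℝ≥0∞) := iInf₂_le (k * τ : ℝ≥0) hi
      _ = ∑ i ∈ Finset.range k, τ * ({i : ℕ | x (i * τ) ∉ S}.indicator 1 i : ℝ≥0∞) := by
        rw [Finset.sum_congr rfl (g := fun _ => (τ : ℝ≥0∞))]
        · simp
        · intro i hi'
          have := Nat.find_min h (Finset.mem_range.1 hi')
          simp [this]
      _ ≤ _ := ENNReal.sum_le_tsum _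
  · push Not at h
    have : ∑' i : ℕ, τ * ({i : ℕ | x (i * τ) ∉ S}.indicator 1 i : ℝ≥0∞) = ⊤ := by
      simp only [Set.indicator, Set.mem_ofPred_eq, h, not_false_eq_true, if_true, Pi.one_apply,
        mul_one]
      exact ENNReal.tsum_const_eq_top_of_ne_zero (by exact_mod_cast hτ.ne')
    rw [this]
    exact le_top

lemma IsQuantizedMetropolis.lintegral_hittingTime_le {G : ℕ → SimpleGraph (Fin n)}
    (hG : ∀ k, (G k).Connected) {N : Sym2 (Fin n) → ℝ≥0 → Ω → ℕ} {x₀ : Fin n → ℤ}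
    {X : ℝ≥0 → Ω → Fin n → ℤ} (hX : IsQuantizedMetropolis P G N x₀ X) {τ : ℕ} (hτ0 : 0 < τ)
    (hτ : 48 * (n : ℝ) ^ 2 * Real.log (2 * (n : ℝ) ^ 2) ≤ τ) :
    ∫⁻ ω, hittingTime (fun t => X t ω) (consensusSet x₀) ∂P ≤
      ENNReal.ofReal (τ * (2 * excess x₀)) := by
  have hmeas : ∀ i : ℕ, MeasurableSet {ω | X (i * τ) ω ∉ consensusSet x₀} := fun i =>
    hX.measurable _ (Set.to_countable (consensusSet x₀)ᶜ).measurableSet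
  have hind : ∀ (i : ℕ) (ω : Ω),
      ({i : ℕ | X (i * τ) ω ∉ consensusSet x₀}.indicator 1 i : ℝ≥0∞) =
      {ω | X (i * τ) ω ∉ consensusSet x₀}.indicator 1 ω := fun _ _ => rfl
  calc _ ≤ ∫⁻ ω, ∑' i : ℕ, τ *
        ({i : ℕ | X (i * τ) ω ∉ consensusSet x₀}.indicator 1 i : ℝ≥0∞) ∂P :=
        lintegral_mono fun ω => hittingTime_le_tsum _ _ hτ0
    _ = ∑' i : ℕ, τ * P {ω | X (i * τ) ω ∉ consensusSet x₀} := by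
      simp_rw [hind]
      rw [lintegral_tsum fun i => ((measurable_one.indicator (hmeas i)).const_mul _).aemeasurable]
      refine tsum_congr fun i => ?_
      rw [lintegral_const_mul _ (measurable_one.indicator (hmeas i)),
        lintegral_indicator_one (hmeas i)]
    _ ≤ _ := by
      rw [ENNReal.tsum_mul_left, ENNReal.ofReal_mul (by positivity), ENNReal.ofReal_natCast]
      gcongr
      rw [ENNReal.tsum_eq_iSup_nat]
      refine iSup_le fun r => ?_
      have := hX.sum_measureReal_notMem_le hG τ hτ r
      rw [show ∑ i ∈ Finset.range r, P {ω | X (i * τ) ω ∉ consensusSet x₀} =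
        ENNReal.ofReal (∑ i ∈ Finset.range r, P.real {ω | X (i * τ) ω ∉ consensusSet x₀}) by
          rw [ENNReal.ofReal_sum_of_nonneg fun i _ => measureReal_nonneg]
          exact Finset.sum_congr rfl fun i _ => (ofReal_measureReal).symm]
      exact ENNReal.ofReal_le_ofReal this

/-- With `t = log n ≥ 1 / 2`, `log (2 n²) ≤ 3 t ≤ 6 t²`; this is where the spare logarithm is spent.
Then `48 * 6 = 288`, and rounding up costs at most `1 ≤ n² t²`. -/
lemma ceil_le_mul_sq_log (hn : 2 ≤ n) :
    (⌈48 * (n : ℝ) ^ 2 * Real.log (2 * (n : ℝ) ^ 2)⌉₊ : ℝ) ≤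
      300 * ((n : ℝ) ^ 2 * Real.log n ^ 2) := by
  have hn' : (2 : ℝ) ≤ n := by exact_mod_cast hn
  have hlog2 : (1 : ℝ) / 2 ≤ Real.log 2 := by linarith [Real.log_two_gt_d9]
  have hlog : Real.log 2 ≤ Real.log n := Real.log_le_log (by norm_num) hn'
  set t := Real.log n
  have h1 : Real.log (2 * (n : ℝ) ^ 2) ≤ 6 * t ^ 2 := by
    rw [Real.log_mul (by norm_num) (by positivity), Real.log_pow]
    push_cast
    nlinarith
  have h0 : 0 ≤ Real.log (2 * (n : ℝ) ^ 2) := Real.log_nonneg (by nlinarith)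
  have h2 := Nat.ceil_lt_add_one (a := 48 * (n : ℝ) ^ 2 * Real.log (2 * (n : ℝ) ^ 2))
    (by positivity)
  have h3 : (1 : ℝ) ≤ (n : ℝ) ^ 2 * t ^ 2 := by
    have : (1 : ℝ) ≤ n * t := by nlinarith
    calc (1 : ℝ) ≤ (n * t) ^ 2 := one_le_pow₀ this
      _ = _ := by ring
  have h4 : 48 * (n : ℝ) ^ 2 * Real.log (2 * (n : ℝ) ^ 2) ≤ 48 * (n : ℝ) ^ 2 * (6 * t ^ 2) := by
    gcongr
  nlinarith

end

end QuantizedMetropolis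

theorem mainTheorem1 :
    ∃ C : ℝ, 0 < C ∧
      ∀ (n : ℕ) (G : ℕ → SimpleGraph (Fin n)), (∀ k, (G k).Connected) →
      ∀ (l L : ℤ) (x₀ : Fin n → ℤ), (∀ i, l ≤ x₀ i ∧ x₀ i ≤ L) →
      ∀ (Ω : Type*) [MeasurableSpace Ω] (P : Measure Ω) [IsProbabilityMeasure P]
        (N : Sym2 (Fin n) → ℝ≥0 → Ω → ℕ) (X : ℝ≥0 → Ω → Fin n → ℤ),
        QuantizedMetropolis.IsQuantizedMetropolis P G N x₀ X →
        ∫⁻ ω, QuantizedMetropolis.hittingTime (fun t => X t ω)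
            (QuantizedMetropolis.consensusSet x₀) ∂P
          ≤ ENNReal.ofReal (C * ((L : ℝ) - (l : ℝ)) * (n : ℝ) ^ 2 * Real.log n ^ 2) := by
  refine ⟨600, by norm_num, fun n G hG l L x₀ hx₀ Ω _ P _ N X hX => ?_⟩
  have hne : Nonempty (Fin n) := (hG 0).nonempty
  have hn : 0 < n := Fin.pos_iff_nonempty.2 hne
  have hn1 : (1 : ℝ) ≤ n := by exact_mod_cast hn
  set τ : ℕ := ⌈48 * (n : ℝ) ^ 2 * Real.log (2 * (n : ℝ) ^ 2)⌉₊ with hτ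
  have hτ0 : 0 < τ := by
    have : 0 < Real.log (2 * (n : ℝ) ^ 2) := Real.log_pos (by nlinarith)
    exact Nat.ceil_pos.2 (by positivity)
  refine (hX.lintegral_hittingTime_le hG hτ0 (Nat.le_ceil _)).trans
    (ENNReal.ofReal_le_ofReal ?_)
  obtain ⟨a, b, _, hs⟩ := QuantizedMetropolis.exists_extremes x₀
  have ha := hx₀ a
  have hb := hx₀ b
  have hexcess : QuantizedMetropolis.excess x₀ ≤ (L : ℝ) - l := by
    have : max (QuantizedMetropolis.spread x₀ - 1) 0 ≤ L - l := by omega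
    unfold QuantizedMetropolis.excess
    exact_mod_cast this
  -- For `n = 1` the right-hand side is `0` since `log 1 = 0`, but then the excess vanishes too.
  rcases Nat.lt_or_ge n 2 with h1 | h2
  · obtain rfl : n = 1 := by omega
    have : QuantizedMetropolis.excess x₀ = 0 := by
      rw [Subsingleton.elim a b] at hs
      simp [QuantizedMetropolis.excess, hs]
    simp [this]
  · have h3 := QuantizedMetropolis.ceil_le_mul_sq_log h2
    calc (τ : ℝ) * (2 * QuantizedMetropolis.excess x₀)
        ≤ 300 * ((n : ℝ) ^ 2 * Real.log n ^ 2) * (2 * ((L : ℝ) - l)) := by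
          have := QuantizedMetropolis.excess_nonneg x₀
          gcongr
      _ = _ := by ring
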